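/- Let $X$ be a complex Banach space, let $U,Y$ be complex Fréchet spaces (complete Hausdorff spaces topologized by countably many seminorms), let $\mathbb T=\mathbb R_{\ge 0}$ (continuous time) or $\mathbb T=\mathbb Z_{\ge 0}$ (discrete time), and let $\Phi:\mathbb T\to\operatorname{End}(X)$ be a strongly continuous semigroup of bounded operators: $\Phi(0)=\mathrm{id}$, $\Phi(t+s)=\Phi(t)\Phi(s)$, and $t\mapsto\Phi(t)x$ is continuous for every $x\in X$ (automatic in discrete time). Let $B:U\to X$, $C:X\to Y$, $D:U\to Y$ be continuous linear operators. In continuous time, let $\mathcal P$ be the set of pairs $(u,y)\in C^\infty([0,\infty),U)\times C^\infty([0,\infty),Y)$ for which there is $x\in C^\infty([0,\infty),X)$ such that for all $t\ge 0$ $$x(t)=\Phi(t)x(0)+\int_0^t\Phi(t-s)Bu(s)\,ds,\qquad y(t)=Cx(t)+Du(t).$$ In discrete time, let $\mathcal P$ be the set of pairs of sequences $(u,y)$ for which there is a sequence $x$ in $X$ such that for all $t\in\mathbb Z_{\ge0}$ $$x(t)=\Phi(t)x(0)+\sum_{0<s\le t}\Phi(t-s)Bu(s),\qquad y(t)=Cx(t)+Du(t),$$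 equivalently $x(k+1)=\Phi(1)x(k)+Bu(k+1)$, $y(k)=Cx(k)+Du(k)$. A function $f$ on $\mathbb T$ vanishes if $f(t)\to0$ as $t\to\infty$; in continuous time it vanishes smoothly if it is smooth and all its derivatives $\partial_t^kf$, $k\ge0$, vanish. A relation $\mathcal P$ is stable if $y$ vanishes whenever $(0,y)\in\mathcal P$; it is VIVO (vanishing-input-vanishing-output) [smoothly VIVO] if $y$ vanishes [smoothly] whenever $(u,y)\in\mathcal P$ and $u$ vanishes [smoothly]. It is well-defined if every input $u$ (smooth, in continuous time) has an output $y$ with $(u,y)\in\mathcal P$. It is input-resilient if it is well-defined and, if stable, is smoothly VIVO (in discrete time: VIVO). **Theorem.** Suppose that $\Phi(1)$ is compact. Then the following are equivalent: (a) $\mathcal P$ is stable; (b) every $v\in X$ such that $(\lambda-\Phi(1))^kv=0$ for some $\lambda\in\mathbb C$ with $|\lambda|\ge1$ and some $k\in\mathbb N$ belongs to the unobservable subspace of $(\Phi,C)$, i.e. the largest subspace of $\operatorname{Ker}C$ invariant under every $\Phi(t)$; (c) $\mathcal P$ is VIVO; and, in continuous time, also (d) $\mathcal P$ is smoothly VIVO.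 In particular, linear time-invariant systems with finite-dimensional state space are input-resilient: if $\dim X<\infty$ and $A\in\operatorname{End}(X)$, then the continuous-time relation of all $(u,y)$ occurring in smooth solutions $(u,x,y)$ of $\dot x=Ax+Bu$, $y=Cx+Du$, and the discrete-time relation defined by $x(k+1)=Ax(k)+Bu(k+1)$, $y(k)=Cx(k)+Du(k)$, are input-resilient. -/

import Mathlib

open Filter Topology
open scoped NNReal

namespace InputOutput

/-! ### Trajectories, smoothness, vanishing

The set of times is `T = ℝ≥0` (continuous time) or `T = ℕ` (discrete time). -/

/-- A trajectory vanishes if it tends to zero as time goes to infinity. -/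
def Vanishes {T E : Type*} [Preorder T] [Zero E] [TopologicalSpace E] (f : T → E) : Prop :=
  Tendsto f atTop (𝓝 0)

section Smooth

variable {E : Type*} [AddCommGroup E] [Module ℂ E] [TopologicalSpace E]

/-- `f'` is the derivative of `f : ℝ≥0 → E` at every time (one-sided at time `0`), as the limit of
difference quotients. The space `E` is only a topological vector space, so that Fréchet spaces are
covered. -/
def HasTimeDeriv (f f' : ℝ≥0 → E) : Prop :=
  ∀ t : ℝ≥0, Tendsto (fun s : ℝ≥0 => ((s : ℝ) - (t : ℝ))⁻¹ • (f s - f t)) (𝓝[≠] t) (𝓝 (f' t))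

/-- `d k` is the `k`-th time derivative of `f`, for every `k`. -/
def IsDerivSeq (f : ℝ≥0 → E) (d : ℕ → ℝ≥0 → E) : Prop :=
  d 0 = f ∧ ∀ k, HasTimeDeriv (d k) (d (k + 1))

/-- `f` is infinitely differentiable on `[0, ∞)`. -/
def IsSmooth (f : ℝ≥0 → E) : Prop := ∃ d, IsDerivSeq f d

/-- `f` is infinitely differentiable and all its derivatives (of order `k ≥ 0`) vanish. -/
def VanishesSmoothly (f : ℝ≥0 → E) : Prop := ∃ d, IsDerivSeq f d ∧ ∀ k, Vanishes (d k)

end Smooth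

/-! ### Input-output relations and their stability properties -/

/-- An input-output relation: a set of pairs (input, output). In continuous time the relations
below contain only pairs of smooth functions. -/
abbrev Relation (T U Y : Type*) := Set ((T → U) × (T → Y))

section Stability

variable {T U Y : Type*} [AddCommGroup U] [AddCommGroup Y] [Module ℂ U] [Module ℂ Y]
  [TopologicalSpace U] [TopologicalSpace Y]

def Stable [Preorder T] (P : Relation T U Y) : Prop :=
  ∀ y : T → Y, ((fun _ => 0 : T → U), y) ∈ P → Vanishes y

/-- Vanishing-input-vanishing-output. -/
def VIVO [Preorder T] (P : Relation T U Y) : Prop :=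
  ∀ u y, (u, y) ∈ P → Vanishes u → Vanishes y

def SmoothlyVIVO (P : Relation ℝ≥0 U Y) : Prop :=
  ∀ u y, (u, y) ∈ P → VanishesSmoothly u → VanishesSmoothly y

/-- A continuous-time relation is input-resilient if every smooth input has an output, and
stability implies smooth VIVO. -/
def InputResilient (P : Relation ℝ≥0 U Y) : Prop :=
  (∀ u : ℝ≥0 → U, IsSmooth u → ∃ y, (u, y) ∈ P) ∧ (Stable P → SmoothlyVIVO P)

/-- In discrete time there are no derivatives: a discrete-time relation is input-resilient if every
input has an output, and stability implies VIVO. -/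
def InputResilientDiscrete (P : Relation ℕ U Y) : Prop :=
  (∀ u : ℕ → U, ∃ y, (u, y) ∈ P) ∧ (Stable P → VIVO P)

end Stability

/-! ### Semigroups and the relations they define -/

/-- A strongly continuous semigroup of bounded operators on `X` with time set `T`
(for `T = ℕ` strong continuity is automatic). -/
structure OpSemigroup (T X : Type*) [AddMonoid T] [TopologicalSpace T]
    [NormedAddCommGroup X] [NormedSpace ℂ X] where
  toFun : T → X →L[ℂ] X
  map_zero : toFun 0 = ContinuousLinearMap.id ℂ X
  map_add : ∀ t s, toFun (t + s) = (toFun t).comp (toFun s)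
  strongly_continuous : ∀ x : X, Continuous fun t => toFun t x

instance {T X : Type*} [AddMonoid T] [TopologicalSpace T]
    [NormedAddCommGroup X] [NormedSpace ℂ X] :
    CoeFun (OpSemigroup T X) (fun _ => T → X →L[ℂ] X) := ⟨OpSemigroup.toFun⟩

section Systems

variable {X U Y : Type*} [NormedAddCommGroup X] [NormedSpace ℂ X]
  [AddCommGroup U] [Module ℂ U] [TopologicalSpace U]
  [AddCommGroup Y] [Module ℂ Y] [TopologicalSpace Y]

/-- The continuous-time relation of all `(u, y)` occurring in smooth solutions `(u, x, y)` of
`x(t) = Φ(t) x(0) + ∫₀ᵗ Φ(t - s) B u(s) ds`, `y(t) = C x(t) + D u(t)`. -/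
def semigroupRelation (Φ : OpSemigroup ℝ≥0 X) (B : U →L[ℂ] X) (C : X →L[ℂ] Y) (D : U →L[ℂ] Y) :
    Relation ℝ≥0 U Y :=
  {p | IsSmooth p.1 ∧ IsSmooth p.2 ∧ ∃ x : ℝ≥0 → X, IsSmooth x ∧
    (∀ t : ℝ≥0, x t = Φ t (x 0) +
      ∫ s in (0 : ℝ)..(t : ℝ), Φ (t - s.toNNReal) (B (p.1 s.toNNReal))) ∧
    ∀ t, p.2 t = C (x t) + D (p.1 t)}

/-- The discrete-time relation of all `(u, y)` occurring in solutions `(u, x, y)` of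
`x(t) = Φ(t) x(0) + ∑_{0 < s ≤ t} Φ(t - s) B u(s)`, `y(t) = C x(t) + D u(t)`. -/
def semigroupRelationDiscrete (Φ : OpSemigroup ℕ X) (B : U →L[ℂ] X) (C : X →L[ℂ] Y)
    (D : U →L[ℂ] Y) : Relation ℕ U Y :=
  {p | ∃ x : ℕ → X,
    (∀ t : ℕ, x t = Φ t (x 0) + ∑ s ∈ Finset.Ioc 0 t, Φ (t - s) (B (p.1 s))) ∧
    ∀ t, p.2 t = C (x t) + D (p.1 t)}

/-- The unobservable subspace of `(Φ, C)`: the largest subspace of `Ker C` that is invariant under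
every `Φ(t)`. -/
def unobservableSubspace {T : Type*} [AddMonoid T] [TopologicalSpace T] (Φ : OpSemigroup T X)
    (C : X →L[ℂ] Y) : Submodule ℂ X :=
  sSup {V | (∀ v ∈ V, C v = 0) ∧ ∀ t, ∀ v ∈ V, Φ t v ∈ V}

/-- `v` is an unstable generalized eigenvector of `A`. -/
def IsUnstableGenEigenvector (A : X →L[ℂ] X) (v : X) : Prop :=
  ∃ (lam : ℂ) (k : ℕ), 1 ≤ ‖lam‖ ∧ ((lam • ContinuousLinearMap.id ℂ X - A) ^ k) v = 0

/-- The relation defined by the differential equation `ẋ = A x + B u`, `y = C x + D u`. -/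
def ltiRelation (A : X →L[ℂ] X) (B : U →L[ℂ] X) (C : X →L[ℂ] Y) (D : U →L[ℂ] Y) :
    Relation ℝ≥0 U Y :=
  {p | IsSmooth p.1 ∧ IsSmooth p.2 ∧ ∃ x : ℝ≥0 → X, IsSmooth x ∧
    HasTimeDeriv x (fun t => A (x t) + B (p.1 t)) ∧
    ∀ t, p.2 t = C (x t) + D (p.1 t)}

/-- The relation defined by the difference equation `x(k+1) = A x(k) + B u(k+1)`,
`y(k) = C x(k) + D u(k)`. -/
def ltiRelationDiscrete (A : X →L[ℂ] X) (B : U →L[ℂ] X) (C : X →L[ℂ] Y) (D : U →L[ℂ] Y) :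
    Relation ℕ U Y :=
  {p | ∃ x : ℕ → X, (∀ k, x (k + 1) = A (x k) + B (p.1 (k + 1))) ∧
    ∀ k, p.2 k = C (x k) + D (p.1 k)}

end Systems

end InputOutput

/-!
The unobservable subspace `N` is closed, invariant under the semigroup and contained in `ker C`, so
outputs depend only on the image of the state in the Banach space `X ⧸ N`. Let `K = Φ(1)`.

*Unobservable unstable modes imply VIVO.* The operator `K̃` induced by `K` on `X ⧸ N` is compact, so
that its nonzero spectrum consists of eigenvalues. If `K̃` had an eigenvalue `lam` with
`‖lam‖ ≥ 1`, there would be `v ∉ N` with `(lam - K) v ∈ N`. By Riesz theory for `K` restricted to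
`N`, every element of `N` is the sum of a generalized eigenvector and an element of `(lam - K) N`
(`IsCompactOperator.exists_pow_apply_sub_eq_zero`). Hence `v` can be corrected by an element of `N`
to a generalized eigenvector of `K`, which lies in `N` by assumption, a contradiction
(`IsCompactOperator.not_hasEigenvalue_quotientMap`). So `K̃` has spectral radius less than one and
some power `K̃ ^ m` has norm at most `1 / 2`. The variation of constants formula over a time window
of length `m` expresses the state at time `t + m` as `K ^ m` applied to the state at time `t`, plus
a term that vanishes with the input; modulo `N` this forces the state to vanish
(`exists_forall_tendsto_output`). For smooth VIVO, the derivatives of a smooth state are mild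
solutions for the derivatives of the input (`IsMildSolution.deriv`), so the same argument applies
to each of them.

*Stability implies that unstable modes are unobservable.* The space `V = ker ((lam - K) ^ k)` is
invariant and, for `lam ≠ 0`, finite-dimensional, so orbits in `V` are smooth
(`OpSemigroup.exists_isDerivSeq_of_finiteDimensional`) and their outputs vanish by stability. If
`‖lam‖ ≥ 1`, induction on `k` shows `C (K ^ n v) = lam ^ n C v` on `V`, which tends to zero only if
`C v = 0` (`apply_eq_zero_of_tendsto_pow`).

*Systems with finite-dimensional state space.* Solutions of `ẋ = A x + B u` are mild solutions for
the semigroup `exp (t A)`, and all operators are compact.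
-/

/-! ### Riesz theory of compact operators -/

section Riesz

variable {E : Type*} [NormedAddCommGroup E] [NormedSpace ℂ E] {K : E →L[ℂ] E} {lam : ℂ}

/-- The ascent of `lam - K` is finite: by Riesz's lemma, a strictly increasing sequence of kernels
would give a bounded sequence whose images under `K` keep a distance at least `‖lam‖`. -/
theorem IsCompactOperator.exists_ker_pow_stable (hK : IsCompactOperator K) (hlam : lam ≠ 0) :
    ∃ p : ℕ, ∀ x, ((lam • ContinuousLinearMap.id ℂ E - K) ^ (p + 1)) x = 0 →
      ((lam • ContinuousLinearMap.id ℂ E - K) ^ p) x = 0 := by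
  set S := lam • ContinuousLinearMap.id ℂ E - K with hS
  by_contra! h
  have hR : ‖(2 : ℂ)‖ < 3 := by norm_num
  have hc : 1 < ‖(2 : ℂ)‖ := by norm_num
  have key (p : ℕ) : ∃ x, (S ^ (p + 1)) x = 0 ∧ ‖x‖ ≤ 3 ∧
      ∀ y, (S ^ p) y = 0 → 1 ≤ ‖x - y‖ := by
    obtain ⟨x, hx1, hx0⟩ := h p
    -- Riesz's lemma for the subspace `ker (S ^ p)` of `ker (S ^ (p + 1))`
    have hcl : IsClosed (((S ^ p).ker.comap (S ^ (p + 1)).ker.subtype :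
        Submodule ℂ (S ^ (p + 1)).ker) : Set (S ^ (p + 1)).ker) :=
      (S ^ p).isClosed_ker.preimage continuous_subtype_val
    obtain ⟨z, hz, hzy⟩ := riesz_lemma_of_norm_lt hc hR hcl
      ⟨⟨x, LinearMap.mem_ker.2 hx1⟩, fun hx => hx0 (LinearMap.mem_ker.1 hx)⟩
    refine ⟨z, LinearMap.mem_ker.1 z.2, hz, fun y hy => ?_⟩
    have hy' : (S ^ (p + 1)) y = 0 := by
      rw [pow_succ', mul_apply_eq_comp, hy, map_zero]
    exact hzy ⟨y, LinearMap.mem_ker.2 hy'⟩ (LinearMap.mem_ker.2 hy)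
  choose x hx0 hx3 hxd using key
  have hmono {a b : ℕ} (hab : a ≤ b) {z : E} (hz : (S ^ a) z = 0) : (S ^ b) z = 0 := by
    obtain ⟨c, rfl⟩ := Nat.exists_eq_add_of_le' hab
    rw [pow_add, mul_apply_eq_comp, hz, map_zero]
  have hKS (z : E) : K z = lam • z - S z := by simp [hS]
  have hsep : ∀ m n : ℕ, m < n → ‖lam‖ ≤ ‖K (x n) - K (x m)‖ := by
    intro m n hmn
    have h1 : (S ^ n) (S (x n)) = 0 := by
      rw [← mul_apply_eq_comp, ← pow_succ]; exact hx0 n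
    have h2 : (S ^ n) (x m) = 0 := hmono hmn (hx0 m)
    have h3 : (S ^ n) (S (x m)) = 0 := by
      rw [← mul_apply_eq_comp, ← pow_succ, pow_succ', mul_apply_eq_comp,
        h2, map_zero]
    have h4 := hxd n (lam⁻¹ • (S (x n) + K (x m))) (by
      rw [hKS (x m), map_smul, map_add, map_sub, map_smul, h1, h2, h3]; simp)
    have h5 : K (x n) - K (x m) = lam • (x n - lam⁻¹ • (S (x n) + K (x m))) := by
      rw [smul_sub, smul_inv_smul₀ hlam, hKS (x n)]; abel
    rw [h5, norm_smul]
    exact le_mul_of_one_le_right (norm_nonneg _) h4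
  obtain ⟨Q, hQ, hQ'⟩ := hK.image_closedBall_subset_compact 3
  obtain ⟨y, -, ψ, hψ, hψy⟩ := hQ.tendsto_subseq
    (fun n => hQ' ⟨x n, by simpa using hx3 n, rfl⟩ : ∀ n, K (x n) ∈ Q)
  obtain ⟨N, hN⟩ := Metric.cauchySeq_iff'.1 hψy.cauchySeq ‖lam‖ (by positivity)
  have h6 := hN (N + 1) (by simp)
  rw [dist_eq_norm_sub] at h6
  exact absurd h6 (hsep _ _ (hψ (Nat.lt_succ_self N))).not_gt

/-- The kernels of the powers of `lam - K` are finite-dimensional, because on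
`ker ((lam - K) ^ k)` the compact operator `lam ^ k - (lam - K) ^ k` is a multiple of the
identity. -/
theorem IsCompactOperator.finiteDimensional_ker_pow (hK : IsCompactOperator K) (hlam : lam ≠ 0)
    (k : ℕ) : FiniteDimensional ℂ ((lam • ContinuousLinearMap.id ℂ E - K) ^ k).ker := by
  set S := lam • ContinuousLinearMap.id ℂ E - K with hS
  have hcomp : ∀ k : ℕ, IsCompactOperator (lam ^ k • (1 : E →L[ℂ] E) - S ^ k) := by
    intro k
    induction k with
    | zero => simpa using isCompactOperator_zero
    | succ k ih =>
      have h : lam ^ (k + 1) • (1 : E →L[ℂ] E) - S ^ (k + 1)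
          = lam • (lam ^ k • (1 : E →L[ℂ] E) - S ^ k) + S ^ k * K := by
        have : K = lam • 1 - S := by rw [hS, ContinuousLinearMap.one_def]; abel
        rw [this, mul_sub, pow_succ S, mul_smul_comm, mul_one, smul_sub, smul_smul, pow_succ' lam]
        abel
      rw [h]
      exact (ih.smul lam).add (hK.clm_comp (S ^ k))
  have hsmul : ∀ v, (S ^ k) v = 0 →
      ((lam ^ k)⁻¹ • (lam ^ k • (1 : E →L[ℂ] E) - S ^ k)) v = v := by
    intro v hv
    have hl : lam ^ k ≠ 0 := pow_ne_zero _ hlam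
    rw [smul_apply, sub_apply, hv, sub_zero, smul_apply, inv_smul_smul₀ hl, one_apply_eq_self]
  have hmaps : ∀ v ∈ (S ^ k).ker,
      ((lam ^ k)⁻¹ • (lam ^ k • (1 : E →L[ℂ] E) - S ^ k)) v ∈ (S ^ k).ker := by
    intro v hv
    rw [hsmul v (LinearMap.mem_ker.1 hv)]
    exact hv
  have h := (((hcomp k).smul (lam ^ k)⁻¹).comp_clm (S ^ k).ker.subtypeL).codRestrict
    (V := (S ^ k).ker) (fun v => hmaps v v.2) (S ^ k).isClosed_ker
  refine FiniteDimensional.of_isCompactOperator_id (𝕜 := ℂ) ?_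
  convert! h using 1
  ext v
  exact (hsmul v (LinearMap.mem_ker.1 v.2)).symm

end Riesz

/-! ### Quotients by invariant subspaces -/

section Quotient

variable {E : Type*} [NormedAddCommGroup E] [NormedSpace ℂ E]

/-- The operator induced by `K` on the quotient by a `K`-invariant subspace. -/
def ContinuousLinearMap.quotientMap (K : E →L[ℂ] E) (N : Submodule ℂ E)
    (hN : ∀ v ∈ N, K v ∈ N) : (E ⧸ N) →L[ℂ] (E ⧸ N) :=
  N.liftQL (N.mkQL.comp K) fun v hv => by simpa using hN v hv

@[simp]
theorem ContinuousLinearMap.quotientMap_mkQL (K : E →L[ℂ] E) (N : Submodule ℂ E)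
    (hN : ∀ v ∈ N, K v ∈ N) (x : E) : K.quotientMap N hN (N.mkQL x) = N.mkQL (K x) := by
  simp [ContinuousLinearMap.quotientMap]

theorem Submodule.mkQL_eq_zero_iff {N : Submodule ℂ E} {x : E} : N.mkQL x = 0 ↔ x ∈ N := by
  simp

theorem IsCompactOperator.quotientMap {K : E →L[ℂ] E} (hK : IsCompactOperator K)
    (N : Submodule ℂ E) (hN : ∀ v ∈ N, K v ∈ N) : IsCompactOperator (K.quotientMap N hN) := by
  obtain ⟨Q, hQ, hKQ⟩ := hK
  refine ⟨N.mkQL '' Q, hQ.image N.mkQL.continuous, ?_⟩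
  have h := N.isOpenQuotientMap_mkQL.isOpenMap.image_mem_nhds hKQ
  rw [map_zero] at h
  refine mem_of_superset h ?_
  rintro _ ⟨x, hx, rfl⟩
  exact ⟨K x, hx, (K.quotientMap_mkQL N hN x).symm⟩

end Quotient

/-! ### Spectrum of the operator induced on a quotient -/

section Spectral

variable {E : Type*} [NormedAddCommGroup E] [NormedSpace ℂ E] [CompleteSpace E]
  {K : E →L[ℂ] E} {lam : ℂ}

/-- `E = ker (lam - K) ^ p + ran (lam - K)` for some `p`: once the kernels have stabilized at
`Z = ker (lam - K) ^ p`, the number `lam` is not an eigenvalue of the operator induced by `K` on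
`E ⧸ Z`, so that the Fredholm alternative applies there. -/
theorem IsCompactOperator.exists_pow_apply_sub_eq_zero (hK : IsCompactOperator K)
    (hlam : lam ≠ 0) : ∃ p : ℕ, ∀ x, ∃ y, ((lam • ContinuousLinearMap.id ℂ E - K) ^ p)
      (x - (lam • ContinuousLinearMap.id ℂ E - K) y) = 0 := by
  obtain ⟨p, hp⟩ := hK.exists_ker_pow_stable hlam
  set S := lam • ContinuousLinearMap.id ℂ E - K with hS
  refine ⟨p, fun x => ?_⟩
  set Z := (S ^ p).ker with hZ
  have hZcl : IsClosed (Z : Set E) := (S ^ p).isClosed_ker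
  have memZ {z : E} : z ∈ Z ↔ (S ^ p) z = 0 := LinearMap.mem_ker
  have hcomm : Commute (S ^ p) K := by
    refine Commute.pow_left ?_ p
    rw [hS, ← ContinuousLinearMap.one_def]
    exact ((Commute.one_left K).smul_left lam).sub_left (Commute.refl K)
  have hZinv : ∀ v ∈ Z, K v ∈ Z := by
    intro v hv
    rw [memZ] at hv ⊢
    rw [← mul_apply_eq_comp, hcomm.eq, mul_apply_eq_comp, hv, map_zero]
  have hmk (z : E) : lam • Z.mkQL z - K.quotientMap Z hZinv (Z.mkQL z) = Z.mkQL (S z) := by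
    rw [ContinuousLinearMap.quotientMap_mkQL, ← map_smul, ← map_sub]; simp [hS]
  have hne : ¬ Module.End.HasEigenvalue
      (K.quotientMap Z hZinv : Module.End ℂ (E ⧸ Z)) lam := by
    intro hev
    obtain ⟨q, hq⟩ := hev.exists_hasEigenvector
    obtain ⟨z, rfl⟩ := Submodule.mkQ_surjective Z q
    have h1 : K.quotientMap Z hZinv (Z.mkQL z) = lam • Z.mkQL z := hq.apply_eq_smul
    have h2 : Z.mkQL (S z) = 0 := by rw [← hmk, h1, sub_self]
    rw [Submodule.mkQL_eq_zero_iff, memZ, ← mul_apply_eq_comp, ← pow_succ] at h2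
    exact hq.2 (Submodule.mkQL_eq_zero_iff.2 (memZ.2 (hp z h2)))
  have hres := ((hK.quotientMap Z hZinv).hasEigenvalue_or_mem_resolventSet hlam).resolve_left hne
  rw [spectrum.mem_resolventSet_iff, ContinuousLinearMap.isUnit_iff_bijective] at hres
  obtain ⟨q, hq⟩ := hres.2 (Z.mkQL x)
  obtain ⟨y, rfl⟩ := Submodule.mkQ_surjective Z q
  refine ⟨y, memZ.1 (Submodule.mkQL_eq_zero_iff.1 ?_)⟩
  rw [map_sub, ← hmk, ← hq]
  simp [Algebra.algebraMap_eq_smul_one]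

/-- If a closed `K`-invariant subspace `N` contains the generalized eigenvectors of `K` for `lam`,
then `lam` is not an eigenvalue of the operator induced on the quotient by `N`. -/
theorem IsCompactOperator.not_hasEigenvalue_quotientMap (hK : IsCompactOperator K)
    (hlam : lam ≠ 0) (N : Submodule ℂ E) (hNcl : IsClosed (N : Set E))
    (hN : ∀ v ∈ N, K v ∈ N)
    (hgen : ∀ v (k : ℕ), ((lam • ContinuousLinearMap.id ℂ E - K) ^ k) v = 0 → v ∈ N) :
    ¬ Module.End.HasEigenvalue (K.quotientMap N hN : Module.End ℂ (E ⧸ N)) lam := by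
  intro hev
  set S := lam • ContinuousLinearMap.id ℂ E - K with hS
  obtain ⟨q, hq⟩ := hev.exists_hasEigenvector
  obtain ⟨v, rfl⟩ := Submodule.mkQ_surjective N q
  have h1 : K.quotientMap N hN (N.mkQL v) = lam • N.mkQL v := hq.apply_eq_smul
  have hSv : S v ∈ N := by
    rw [← Submodule.mkQL_eq_zero_iff]
    rw [ContinuousLinearMap.quotientMap_mkQL] at h1
    simp only [hS, sub_apply, smul_apply,
      ContinuousLinearMap.id_apply, map_sub, map_smul]
    rw [h1, sub_self]
  have : CompleteSpace N := hNcl.completeSpace_coe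
  let KN : N →L[ℂ] N := (K.comp N.subtypeL).codRestrict N fun v => hN v v.2
  have hKN : IsCompactOperator KN :=
    (hK.comp_clm N.subtypeL).codRestrict (V := N) (fun v => hN v v.2) hNcl
  obtain ⟨p, hp⟩ := hKN.exists_pow_apply_sub_eq_zero hlam
  obtain ⟨y, hy⟩ := hp ⟨S v, hSv⟩
  have hcoe (k : ℕ) (z : N) :
      ((((lam • ContinuousLinearMap.id ℂ N - KN) ^ k) z : N) : E) = (S ^ k) (z : E) := by
    induction k generalizing z with
    | zero => simp
    | succ k ih =>
      rw [pow_succ, pow_succ, mul_apply_eq_comp, ih, mul_apply_eq_comp]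
      rfl
  -- `S v` agrees with `S y` up to a generalized eigenvector, so `v - y` is one
  have h2 : (S ^ (p + 1)) (v - y) = 0 := by
    have h3 := congrArg (Subtype.val) hy
    rw [hcoe] at h3
    rw [pow_succ, mul_apply_eq_comp, map_sub]
    exact h3
  have h4 : v ∈ N := by simpa using N.add_mem (hgen _ _ h2) y.2
  exact hq.2 (Submodule.mkQL_eq_zero_iff.2 h4)

/-- If a compact operator has no eigenvalues outside the open unit disc, some power of it is a
strict contraction. -/
theorem IsCompactOperator.exists_norm_pow_le_half (hK : IsCompactOperator K)
    (h : ∀ lam : ℂ, 1 ≤ ‖lam‖ → ¬ Module.End.HasEigenvalue (K : Module.End ℂ E) lam) :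
    ∃ m : ℕ, 0 < m ∧ ‖K ^ m‖ ≤ 1 / 2 := by
  have hspec : ∀ z ∈ spectrum ℂ K, ‖z‖₊ < 1 := by
    intro z hz
    by_contra! hge
    have hge' : 1 ≤ ‖z‖ := hge
    have hz0 : z ≠ 0 := fun h0 => by simp [h0] at hge'; linarith
    exact h z hge' ((hK.hasEigenvalue_iff_mem_spectrum hz0).2 hz)
  have hr : spectralRadius ℂ K < (1 : ℝ≥0) := by
    rcases (spectrum ℂ K).eq_empty_or_nonempty with he | hne
    · simp [spectralRadius, he]
    · exact spectrum.spectralRadius_lt_of_forall_lt_of_nonempty hne hspec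
  obtain ⟨r, hr1, hr2⟩ := ENNReal.lt_iff_exists_nnreal_btwn.1 hr
  have hr2' : r < 1 := by exact_mod_cast hr2
  have hlim := spectrum.pow_nnnorm_pow_one_div_tendsto_nhds_spectralRadius K
  have hpow : Tendsto (fun n : ℕ => (r : ℝ) ^ n) atTop (𝓝 0) :=
    tendsto_pow_atTop_nhds_zero_of_lt_one r.2 (by exact_mod_cast hr2')
  obtain ⟨m, hm1, hm2, hm3⟩ := ((hlim.eventually (gt_mem_nhds hr1)).and
    ((hpow.eventually (gt_mem_nhds (show (0 : ℝ) < 1 / 2 by norm_num))).and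
      (eventually_gt_atTop 0))).exists
  refine ⟨m, hm3, ?_⟩
  have hm4 : (‖K ^ m‖₊ : ENNReal) < (r : ENNReal) ^ m := by
    have := ENNReal.rpow_lt_rpow hm1 (show (0 : ℝ) < m by exact_mod_cast hm3)
    rwa [← ENNReal.rpow_mul, one_div, inv_mul_cancel₀ (by exact_mod_cast hm3.ne'),
      ENNReal.rpow_one, ENNReal.rpow_natCast] at this
  have hm5 : ‖K ^ m‖₊ < r ^ m := by exact_mod_cast hm4
  have hm6 : ‖K ^ m‖ < (r : ℝ) ^ m := by exact_mod_cast hm5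
  linarith

end Spectral

namespace InputOutput

/-! ### Semigroups and the unobservable subspace -/

section Unobservable

variable {T X Y : Type*} [TopologicalSpace T] [NormedAddCommGroup X] [NormedSpace ℂ X]
  [AddCommGroup Y] [Module ℂ Y] [TopologicalSpace Y]

theorem tendsto_clm_zero {ι E F : Type*} [AddCommGroup E] [Module ℂ E] [TopologicalSpace E]
    [AddCommGroup F] [Module ℂ F] [TopologicalSpace F] (L : E →L[ℂ] F) {l : Filter ι} {f : ι → E}
    (hf : Tendsto f l (𝓝 0)) : Tendsto (fun i => L (f i)) l (𝓝 0) := by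
  have h := (L.continuous.tendsto 0).comp hf
  rwa [map_zero] at h

theorem OpSemigroup.map_nsmul [AddMonoid T] (Φ : OpSemigroup T X) (τ : T) (n : ℕ) :
    Φ (n • τ) = Φ τ ^ n := by
  induction n with
  | zero => rw [zero_smul, pow_zero, Φ.map_zero]; rfl
  | succ n ih => rw [succ_nsmul, Φ.map_add, ih, pow_succ]; rfl

theorem OpSemigroup.commute [AddCommMonoid T] (Φ : OpSemigroup T X) (t s : T) :
    Commute (Φ t) (Φ s) := by
  have h1 := Φ.map_add t s
  rw [add_comm, Φ.map_add] at h1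
  exact h1.symm

/-- The subspace `ker ((lam - Φ τ) ^ k)` is invariant under the semigroup. -/
theorem OpSemigroup.mem_ker_pow [AddCommMonoid T] (Φ : OpSemigroup T X) (τ : T) (lam : ℂ) (k : ℕ)
    {v : X} (hv : ((lam • ContinuousLinearMap.id ℂ X - Φ τ) ^ k) v = 0) (t : T) :
    ((lam • ContinuousLinearMap.id ℂ X - Φ τ) ^ k) (Φ t v) = 0 := by
  have hcomm : Commute ((lam • ContinuousLinearMap.id ℂ X - Φ τ) ^ k) (Φ t) := by
    refine Commute.pow_left ?_ k
    rw [← ContinuousLinearMap.one_def]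
    exact ((Commute.one_left (Φ t)).smul_left lam).sub_left (Φ.commute τ t)
  rw [← mul_apply_eq_comp, hcomm.eq, mul_apply_eq_comp, hv]
  exact (Φ t).map_zero

theorem le_unobservableSubspace [AddMonoid T] {Φ : OpSemigroup T X} {C : X →L[ℂ] Y}
    {V : Submodule ℂ X} (hC : ∀ v ∈ V, C v = 0) (hΦ : ∀ t, ∀ v ∈ V, Φ t v ∈ V) :
    V ≤ unobservableSubspace Φ C :=
  le_sSup ⟨hC, hΦ⟩

theorem apply_eq_zero_of_mem_unobservableSubspace [AddMonoid T] {Φ : OpSemigroup T X}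
    {C : X →L[ℂ] Y} {v : X} (hv : v ∈ unobservableSubspace Φ C) : C v = 0 :=
  (sSup_le fun _ hV v hv => LinearMap.mem_ker.2 (hV.1 v hv) :
    unobservableSubspace Φ C ≤ C.toLinearMap.ker) hv

theorem apply_mem_unobservableSubspace [AddMonoid T] {Φ : OpSemigroup T X}
    {C : X →L[ℂ] Y} (t : T) {v : X} (hv : v ∈ unobservableSubspace Φ C) :
    Φ t v ∈ unobservableSubspace Φ C :=
  (sSup_le fun _ hV v hv => le_unobservableSubspace hV.1 hV.2 (hV.2 t v hv) :
    unobservableSubspace Φ C ≤ (unobservableSubspace Φ C).comap (Φ t).toLinearMap) hv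

theorem isClosed_unobservableSubspace [AddMonoid T] [T1Space Y] (Φ : OpSemigroup T X)
    (C : X →L[ℂ] Y) : IsClosed (unobservableSubspace Φ C : Set X) := by
  set N := unobservableSubspace Φ C
  have hle : N.topologicalClosure ≤ N := by
    refine le_unobservableSubspace (fun v hv => ?_) fun t v hv => ?_
    · have hcl : IsClosed {v : X | C v = 0} := isClosed_singleton.preimage C.continuous
      exact closure_minimal (fun w hw => apply_eq_zero_of_mem_unobservableSubspace hw) hcl hv
    · exact map_mem_closure (Φ t).continuous hv fun w hw => apply_mem_unobservableSubspace t hw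
  exact le_antisymm hle N.le_topologicalClosure ▸ N.isClosed_topologicalClosure

end Unobservable

/-! ### Unstable modes with vanishing output are unobservable -/

section Modes

variable {X Y : Type*} [NormedAddCommGroup X] [NormedSpace ℂ X]
  [AddCommGroup Y] [Module ℂ Y] [TopologicalSpace Y] [ContinuousSMul ℂ Y] [T2Space Y]

theorem eq_zero_of_tendsto_pow_smul {lam : ℂ} (hlam : 1 ≤ ‖lam‖) {c : Y}
    (h : Tendsto (fun n : ℕ => lam ^ n • c) atTop (𝓝 0)) : c = 0 := by
  by_contra hc
  -- a balanced neighbourhood of zero that does not contain `c`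
  obtain ⟨W, ⟨hW0, hW⟩, hWc⟩ := (nhds_basis_balanced ℂ Y).mem_iff.1
    (isOpen_compl_singleton.mem_nhds (Ne.symm hc) : ({c}ᶜ : Set Y) ∈ 𝓝 0)
  obtain ⟨n, hn⟩ := (h.eventually_mem hW0).exists
  have hlam0 : lam ^ n ≠ 0 := pow_ne_zero _ (norm_pos_iff.1 (by linarith))
  have h1 : (lam ^ n)⁻¹ • lam ^ n • c ∈ W := by
    refine hW.smul_mem ?_ hn
    rw [norm_inv, norm_pow]
    exact inv_le_one_of_one_le₀ (one_le_pow₀ hlam)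
  rw [inv_smul_smul₀ hlam0] at h1
  exact hWc h1 rfl

/-- If all outputs along the orbits in the generalized eigenspace `ker ((lam - K) ^ k)` vanish and
`‖lam‖ ≥ 1`, then the observation is zero there. By induction on `k`, the vector `K v - lam v`
produces the zero output, whence `C (K ^ n v) = lam ^ n C v`. -/
theorem apply_eq_zero_of_tendsto_pow {K : X →L[ℂ] X} {C : X →L[ℂ] Y} {lam : ℂ}
    (hlam : 1 ≤ ‖lam‖) (k : ℕ)
    (h : ∀ v, ((lam • ContinuousLinearMap.id ℂ X - K) ^ k) v = 0 →
      Tendsto (fun n : ℕ => C ((K ^ n) v)) atTop (𝓝 0)) :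
    ∀ v, ((lam • ContinuousLinearMap.id ℂ X - K) ^ k) v = 0 → C v = 0 := by
  set S := lam • ContinuousLinearMap.id ℂ X - K with hS
  have hSK : Commute S K := by
    rw [hS, ← ContinuousLinearMap.one_def]
    exact ((Commute.one_left K).smul_left lam).sub_left (Commute.refl K)
  induction k with
  | zero => intro v hv; rw [pow_zero, one_apply_eq_self] at hv; rw [hv, map_zero]
  | succ k ih =>
    have ih' := ih fun v hv => h v (by rw [pow_succ', mul_apply_eq_comp, hv, map_zero])
    intro v hv
    have hker (n : ℕ) : (S ^ k) ((K ^ n) (S v)) = 0 := by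
      rw [← mul_apply_eq_comp, ((hSK.pow_left k).pow_right n).eq, mul_apply_eq_comp,
        ← mul_apply_eq_comp (S ^ k), ← pow_succ, hv, map_zero]
    have hpow (n : ℕ) : C ((K ^ n) v) = lam ^ n • C v := by
      induction n with
      | zero => simp
      | succ n ihn =>
        have hKv : K v = lam • v - S v := by simp [hS]
        rw [pow_succ, mul_apply_eq_comp, hKv, map_sub, map_sub, ih' _ (hker n), map_smul, map_smul,
          ihn, smul_smul, sub_zero, pow_succ']
    refine eq_zero_of_tendsto_pow_smul hlam ?_
    simpa only [hpow] using h v hv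

/-- The subspace `ker ((lam - Φ τ) ^ k)` is itself invariant and contained in `ker C`. -/
theorem mem_unobservableSubspace_of_tendsto {T : Type*} [TopologicalSpace T] [AddCommMonoid T]
    (Φ : OpSemigroup T X) (C : X →L[ℂ] Y) (τ : T) {lam : ℂ} (hlam : 1 ≤ ‖lam‖) (k : ℕ)
    (h : ∀ v, ((lam • ContinuousLinearMap.id ℂ X - Φ τ) ^ k) v = 0 →
      Tendsto (fun n : ℕ => C ((Φ τ ^ n) v)) atTop (𝓝 0))
    {v : X} (hv : ((lam • ContinuousLinearMap.id ℂ X - Φ τ) ^ k) v = 0) :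
    v ∈ unobservableSubspace Φ C :=
  le_unobservableSubspace (V := ((lam • ContinuousLinearMap.id ℂ X - Φ τ) ^ k).ker)
    (fun w hw => apply_eq_zero_of_tendsto_pow hlam k h w (LinearMap.mem_ker.1 hw))
    (fun t _ hw => LinearMap.mem_ker.2 (Φ.mem_ker_pow τ lam k (LinearMap.mem_ker.1 hw) t))
    (LinearMap.mem_ker.2 hv)

end Modes

/-! ### Decay of the observed part of the state -/

section Decay

/-- Once `b ≤ ε / 4`, the function `a` is bounded by some `M + ε / 2`, and each further shift by `m`
halves the excess over `ε / 2`. -/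
theorem tendsto_zero_of_le_half_add {a b : ℝ≥0 → ℝ} {m : ℕ} (hm : 0 < m) (ha : ∀ t, 0 ≤ a t)
    (hab : ∀ t, a (t + m) ≤ a t / 2 + b t) (hb : Tendsto b atTop (𝓝 0))
    (hbdd : ∀ R, ∃ M, ∀ t ≤ R, a t ≤ M) : Tendsto a atTop (𝓝 0) := by
  rw [Metric.tendsto_atTop]
  intro ε hε
  obtain ⟨T₀, hT₀⟩ := Filter.eventually_atTop.1
    (hb.eventually (gt_mem_nhds (show (0 : ℝ) < ε / 4 by positivity)))
  obtain ⟨M, hM⟩ := hbdd (T₀ + m)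
  have hM0 : 0 ≤ M := (ha T₀).trans (hM T₀ (by simp))
  -- a time `t ≥ T₀ + m` is the shift by `m` of the time `t - m ≥ T₀`
  have hback {t r : ℝ≥0} (hr : r + m ≤ t) : t = (t - m) + m ∧ r ≤ t - m :=
    ⟨(tsub_add_cancel_of_le (le_add_self.trans hr)).symm, le_tsub_of_add_le_right hr⟩
  have hall : ∀ j : ℕ, ∀ t, T₀ ≤ t → t ≤ T₀ + (j + 1) * m → a t ≤ M + ε / 2 := by
    intro j
    induction j with
    | zero => intro t _ ht; have := hM t (by simpa using ht); linarith
    | succ j ih =>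
      intro t h1 h2
      rcases le_total t (T₀ + m) with h3 | h3
      · have := hM t h3; linarith
      · obtain ⟨h4, h5⟩ := hback h3
        have h6 := ih (t - m) h5 (by
          rw [tsub_le_iff_right]; push_cast at h2; exact h2.trans (le_of_eq (by ring)))
        have h7 := hab (t - m)
        rw [← h4] at h7
        have h8 := hT₀ _ h5
        linarith
  have hbound : ∀ t, T₀ ≤ t → a t ≤ M + ε / 2 := by
    intro t ht
    obtain ⟨j, hj⟩ := exists_nat_ge t
    refine hall j t ht (hj.trans ?_)
    have hm' : (1 : ℝ≥0) ≤ m := by exact_mod_cast hm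
    calc (j : ℝ≥0) ≤ j + 1 := by simp
      _ ≤ (j + 1) * m := le_mul_of_one_le_right (by positivity) hm'
      _ ≤ _ := le_add_self
  have hgeom : ∀ k : ℕ, ∀ t, T₀ + k * m ≤ t → a t ≤ M / 2 ^ k + ε / 2 := by
    intro k
    induction k with
    | zero => intro t ht; simpa using hbound t (by simpa using ht)
    | succ k ih =>
      intro t ht
      obtain ⟨h4, h5⟩ := hback (r := T₀ + k * m) (t := t)
        (le_trans (le_of_eq (by push_cast; ring)) ht)
      have h6 := ih _ h5
      have h7 := hab (t - m)
      rw [← h4] at h7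
      have h8 := hT₀ _ (le_self_add.trans h5)
      rw [pow_succ, ← div_div]
      linarith
  obtain ⟨k, hk⟩ := (((tendsto_pow_atTop_nhds_zero_of_lt_one (r := (1 / 2 : ℝ)) (by norm_num)
    (by norm_num)).const_mul M).eventually (gt_mem_nhds
      (show M * 0 < ε / 2 by rw [mul_zero]; positivity))).exists
  refine ⟨T₀ + k * m, fun t ht => ?_⟩
  have h9 := hgeom k t ht
  rw [Real.dist_eq, sub_zero, abs_of_nonneg (ha t)]
  rw [one_div, inv_pow, ← div_eq_mul_inv] at hk
  linarith

variable {X Y : Type*} [NormedAddCommGroup X] [NormedSpace ℂ X] [CompleteSpace X]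
  [AddCommGroup Y] [Module ℂ Y] [TopologicalSpace Y]

/-- Let the closed invariant subspace `N ≤ ker C` contain the unstable generalized eigenvectors of
the compact operator `K`. The operator induced on `X ⧸ N` has a power of norm at most `1 / 2`, so
that solutions of `x (t + m) = K ^ m (x t) + g t` with vanishing `g` have vanishing image in
`X ⧸ N`, and hence vanishing output. -/
theorem exists_forall_tendsto_output {K : X →L[ℂ] X} (hK : IsCompactOperator K) {C : X →L[ℂ] Y}
    {N : Submodule ℂ X} (hNcl : IsClosed (N : Set X)) (hNK : ∀ v ∈ N, K v ∈ N)
    (hNC : ∀ v ∈ N, C v = 0) (hgen : ∀ v, IsUnstableGenEigenvector K v → v ∈ N) :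
    ∃ m : ℕ, 0 < m ∧ ∀ x g : ℝ≥0 → X, (∀ t, x (t + m) = (K ^ m) (x t) + g t) →
      Tendsto g atTop (𝓝 0) → (∀ R, ∃ M, ∀ t ≤ R, ‖x t‖ ≤ M) →
      Tendsto (fun t => C (x t)) atTop (𝓝 0) := by
  obtain ⟨m, hm, hnorm⟩ := (hK.quotientMap N hNK).exists_norm_pow_le_half fun lam hlam =>
    hK.not_hasEigenvalue_quotientMap (norm_pos_iff.1 (by linarith)) N hNcl hNK
      fun v k hv => hgen v ⟨lam, k, hlam, hv⟩
  refine ⟨m, hm, fun x g hx hg hbdd => ?_⟩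
  have hpow (k : ℕ) (v : X) : N.mkQL ((K ^ k) v) = (K.quotientMap N hNK ^ k) (N.mkQL v) := by
    induction k generalizing v with
    | zero => rfl
    | succ k ih => rw [pow_succ, mul_apply_eq_comp, ih, pow_succ, mul_apply_eq_comp,
        ContinuousLinearMap.quotientMap_mkQL]
  have hle (v : X) : ‖N.mkQL v‖ ≤ ‖v‖ := Submodule.Quotient.norm_mk_le (S := N) v
  have hlim : Tendsto (fun t => ‖N.mkQL (x t)‖) atTop (𝓝 0) := by
    refine tendsto_zero_of_le_half_add (b := fun t => ‖N.mkQL (g t)‖) hm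
      (fun t => norm_nonneg _) (fun t => ?_) ?_ fun R => ?_
    · rw [hx, map_add, hpow]
      refine (norm_add_le _ _).trans (add_le_add_left ?_ _)
      refine ((K.quotientMap N hNK ^ m).le_opNorm _).trans ?_
      have := mul_le_mul_of_nonneg_right hnorm (norm_nonneg (N.mkQL (x t)))
      linarith
    · exact squeeze_zero (fun t => norm_nonneg _) (fun t => hle _)
        (tendsto_zero_iff_norm_tendsto_zero.1 hg)
    · obtain ⟨M, hM⟩ := hbdd R
      exact ⟨M, fun t ht => (hle _).trans (hM t ht)⟩
  have hlim' := tendsto_zero_iff_norm_tendsto_zero.2 hlim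
  exact tendsto_clm_zero (N.liftQL C fun v hv => LinearMap.mem_ker.2 (hNC v hv)) hlim'

end Decay

/-! ### Discrete time -/

section Discrete

variable {X U Y : Type*} [NormedAddCommGroup X] [NormedSpace ℂ X]
  [AddCommGroup U] [Module ℂ U] [TopologicalSpace U]
  [AddCommGroup Y] [Module ℂ Y] [TopologicalSpace Y]

/-- The summation formula for the state is equivalent to the one-step recursion. -/
theorem eq_sum_iff_forall_succ (Φ : OpSemigroup ℕ X) (x f : ℕ → X) :
    (∀ t : ℕ, x t = Φ t (x 0) + ∑ s ∈ Finset.Ioc 0 t, Φ (t - s) (f s)) ↔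
      ∀ k, x (k + 1) = Φ 1 (x k) + f (k + 1) := by
  have hΦ (k : ℕ) (v : X) : Φ (k + 1) v = Φ 1 (Φ k v) := by
    rw [add_comm, Φ.map_add]; rfl
  have hsum (k : ℕ) : ∑ s ∈ Finset.Ioc 0 (k + 1), Φ (k + 1 - s) (f s)
      = Φ 1 (∑ s ∈ Finset.Ioc 0 k, Φ (k - s) (f s)) + f (k + 1) := by
    rw [Finset.sum_Ioc_succ_top (Nat.zero_le k), map_sum, Nat.sub_self, Φ.map_zero]
    congr 1
    refine Finset.sum_congr rfl fun s hs => ?_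
    rw [Nat.sub_add_comm (Finset.mem_Ioc.1 hs).2, hΦ]
  constructor
  · intro h k
    rw [h (k + 1), hsum, hΦ k, h k]
    simp only [map_add, add_assoc]
  · intro h t
    induction t with
    | zero => simp [Φ.map_zero]
    | succ t ih => rw [h t, hsum, hΦ t, ih]; simp [map_add, add_assoc]

theorem exists_shift_eq {A : X →L[ℂ] X} {x f : ℕ → X} (hx : ∀ k, x (k + 1) = A (x k) + f (k + 1))
    (hf : Tendsto f atTop (𝓝 0)) (m : ℕ) :
    ∃ g : ℕ → X, Tendsto g atTop (𝓝 0) ∧ ∀ n, x (n + m) = (A ^ m) (x n) + g n := by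
  induction m with
  | zero => exact ⟨fun _ => 0, tendsto_const_nhds, fun n => by simp⟩
  | succ m ih =>
    obtain ⟨g, hg, hgx⟩ := ih
    refine ⟨fun n => A (g n) + f (n + (m + 1)), ?_, fun n => ?_⟩
    · simpa using (tendsto_clm_zero A hg).add (hf.comp (tendsto_add_atTop_nat (m + 1)))
    · rw [← add_assoc, hx, hgx, map_add, pow_succ', mul_apply_eq_comp]
      simp only [add_assoc]

theorem tfae_stable_discrete [CompleteSpace X] [IsTopologicalAddGroup Y] [ContinuousSMul ℂ Y]
    [T2Space Y] (B : U →L[ℂ] X) (C : X →L[ℂ] Y) (D : U →L[ℂ] Y) (Φ : OpSemigroup ℕ X)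
    (hΦ : IsCompactOperator (Φ 1)) :
    List.TFAE [Stable (semigroupRelationDiscrete Φ B C D),
      ∀ v : X, IsUnstableGenEigenvector (Φ 1) v → v ∈ unobservableSubspace Φ C,
      VIVO (semigroupRelationDiscrete Φ B C D)] := by
  tfae_have 1 → 2 := by
    rintro h v ⟨lam, k, hlam, hv⟩
    refine mem_unobservableSubspace_of_tendsto Φ C 1 hlam k (fun w _ => ?_) hv
    refine h _ ⟨fun n => (Φ 1 ^ n) w, (eq_sum_iff_forall_succ Φ _ _).2 fun n => ?_, fun n => ?_⟩
    · simp [pow_succ', mul_apply_eq_comp]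
    · simp
  tfae_have 2 → 3 := by
    rintro h u y ⟨x, hx, hy⟩ hu
    have hx' := (eq_sum_iff_forall_succ Φ x (fun s => B (u s))).1 hx
    have hBu := tendsto_clm_zero B hu
    have hDu := tendsto_clm_zero D hu
    obtain ⟨m, -, hm⟩ := exists_forall_tendsto_output hΦ (isClosed_unobservableSubspace Φ C)
      (fun v hv => apply_mem_unobservableSubspace 1 hv)
      (fun v hv => apply_eq_zero_of_mem_unobservableSubspace hv) h
    obtain ⟨g, hg, hgx⟩ := exists_shift_eq hx' hBu m
    -- the sequences are extended to real times as step functions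
    have hlim := hm (fun t => x ⌊t⌋₊) (fun t => g ⌊t⌋₊)
      (fun t => by rw [Nat.floor_add_natCast zero_le, hgx]) (hg.comp tendsto_nat_floor_atTop)
      fun R => by
        obtain ⟨M, hM⟩ := ((Set.finite_Iic ⌊R⌋₊).image fun n => ‖x n‖).bddAbove
        exact ⟨M, fun t ht => hM ⟨⌊t⌋₊, Nat.floor_mono ht, rfl⟩⟩
    have hCx : Tendsto (fun n => C (x n)) atTop (𝓝 0) := by
      simpa [Function.comp_def] using hlim.comp (tendsto_natCast_atTop_atTop (R := ℝ≥0))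
    have := hCx.add hDu
    rw [add_zero] at this
    exact this.congr fun n => (hy n).symm
  tfae_have 3 → 1 := fun h y hy => h _ y hy tendsto_const_nhds
  tfae_finish

end Discrete

/-! ### Time derivatives -/

section TimeDeriv

variable {E F : Type*} [AddCommGroup E] [Module ℂ E] [TopologicalSpace E]
  [AddCommGroup F] [Module ℂ F] [TopologicalSpace F]

theorem HasTimeDeriv.clm_comp {f f' : ℝ≥0 → E} (hf : HasTimeDeriv f f') (L : E →L[ℂ] F) :
    HasTimeDeriv (fun t => L (f t)) (fun t => L (f' t)) := by
  intro t
  refine ((L.continuous.tendsto (f' t)).comp (hf t)).congr fun s => ?_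
  simp only [Function.comp_apply, ← map_sub]
  exact L.toLinearMap.map_smul_of_tower _ _

theorem HasTimeDeriv.add [ContinuousAdd E] {f f' g g' : ℝ≥0 → E} (hf : HasTimeDeriv f f')
    (hg : HasTimeDeriv g g') : HasTimeDeriv (fun t => f t + g t) (fun t => f' t + g' t) := by
  intro t
  refine ((hf t).add (hg t)).congr fun s => ?_
  rw [← smul_add, add_sub_add_comm]

theorem hasTimeDeriv_zero : HasTimeDeriv (fun _ => 0 : ℝ≥0 → E) (fun _ => 0) := by
  intro t
  simpa using tendsto_const_nhds

theorem isDerivSeq_zero : IsDerivSeq (fun _ => 0 : ℝ≥0 → E) (fun _ _ => 0) :=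
  ⟨rfl, fun _ => hasTimeDeriv_zero⟩

theorem IsDerivSeq.clm_comp {f : ℝ≥0 → E} {d : ℕ → ℝ≥0 → E} (h : IsDerivSeq f d) (L : E →L[ℂ] F) :
    IsDerivSeq (fun t => L (f t)) (fun k t => L (d k t)) :=
  ⟨by simp only [h.1], fun k => (h.2 k).clm_comp L⟩

theorem IsDerivSeq.add [ContinuousAdd E] {f g : ℝ≥0 → E} {d e : ℕ → ℝ≥0 → E} (hf : IsDerivSeq f d)
    (hg : IsDerivSeq g e) : IsDerivSeq (fun t => f t + g t) (fun k t => d k t + e k t) :=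
  ⟨by simp only [hf.1, hg.1], fun k => (hf.2 k).add (hg.2 k)⟩

end TimeDeriv

section NormedTimeDeriv

variable {E : Type*} [NormedAddCommGroup E] [NormedSpace ℂ E]

theorem map_coe_nhdsNE (t : ℝ≥0) :
    map ((↑) : ℝ≥0 → ℝ) (𝓝[≠] t) = 𝓝[Set.Ici 0 \ {(t : ℝ)}] (t : ℝ) := by
  have h : ((↑) : ℝ≥0 → ℝ) '' {t}ᶜ = Set.Ici 0 \ {(t : ℝ)} := by
    ext r
    constructor
    · rintro ⟨s, hs, rfl⟩
      exact ⟨s.2, fun h => hs (NNReal.coe_injective h)⟩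
    · rintro ⟨hr, hrt⟩
      exact ⟨⟨r, hr⟩, fun h => hrt (by rw [← h]; rfl), rfl⟩
  rw [← h]
  exact NNReal.isEmbedding_coe.map_nhdsWithin_eq _ _

/-- In a normed space, time derivatives are derivatives within `[0, ∞)` of the extension to real
times. -/
theorem hasTimeDeriv_iff {f f' : ℝ≥0 → E} :
    HasTimeDeriv f f' ↔
      ∀ t : ℝ≥0, HasDerivWithinAt (fun r : ℝ => f r.toNNReal) (f' t) (Set.Ici 0) t := by
  refine forall_congr' fun t => ?_
  rw [hasDerivWithinAt_iff_tendsto_slope, ← map_coe_nhdsNE, tendsto_map'_iff]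
  refine tendsto_congr fun s => ?_
  simp [slope_def_module]

theorem HasTimeDeriv.hasDerivAt {f f' : ℝ≥0 → E} (hf : HasTimeDeriv f f') {r : ℝ} (hr : 0 < r) :
    HasDerivAt (fun r : ℝ => f r.toNNReal) (f' r.toNNReal) r := by
  have h := hasTimeDeriv_iff.1 hf r.toNNReal
  rw [Real.coe_toNNReal r hr.le] at h
  exact h.hasDerivAt (Ici_mem_nhds hr)

theorem HasTimeDeriv.continuous {f f' : ℝ≥0 → E} (hf : HasTimeDeriv f f') : Continuous f := by
  have h : ContinuousOn (fun r : ℝ => f r.toNNReal) (Set.Ici 0) := fun r hr => by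
    have h1 := (hasTimeDeriv_iff.1 hf r.toNNReal).continuousWithinAt
    rwa [Real.coe_toNNReal r hr] at h1
  have h2 := h.comp_continuous NNReal.continuous_coe fun t => t.2
  simpa [Function.comp_def] using h2

theorem IsSmooth.continuous {f : ℝ≥0 → E} (hf : IsSmooth f) : Continuous f := by
  obtain ⟨d, rfl, hd⟩ := hf
  exact (hd 0).continuous

theorem HasTimeDeriv.norm_sub_le {f f' : ℝ≥0 → E} (hf : HasTimeDeriv f f') {s h : ℝ≥0} {M : ℝ}
    (hM : ∀ r ≤ h + s, ‖f' r‖ ≤ M) : ‖f (h + s) - f s‖ ≤ M * h := by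
  have key := norm_image_sub_le_of_norm_deriv_le_segment' (f := fun r : ℝ => f r.toNNReal)
    (f' := fun r => f' r.toNNReal) (a := s) (b := (h + s : ℝ≥0)) (C := M)
    (fun r hr => ?_) (fun r hr => hM _ (Real.toNNReal_le_iff_le_coe.2 hr.2.le))
    ((h + s : ℝ≥0) : ℝ) (Set.right_mem_Icc.2 (by simp))
  · simpa using key
  · have hr0 : 0 ≤ r := s.2.trans hr.1
    have h1 := hasTimeDeriv_iff.1 hf r.toNNReal
    rw [Real.coe_toNNReal r hr0] at h1
    exact h1.mono fun q hq => s.2.trans hq.1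

end NormedTimeDeriv

/-! ### Strongly continuous semigroups and mild solutions -/

section Mild

theorem exists_norm_le_of_continuous {X : Type*} [NormedAddCommGroup X] {f : ℝ≥0 → X}
    (hf : Continuous f) (R : ℝ≥0) :
    ∃ M, ∀ t ≤ R, ‖f t‖ ≤ M := by
  obtain ⟨M, hM⟩ := (isCompact_Icc (a := 0) (b := R)).exists_bound_of_continuousOn hf.continuousOn
  exact ⟨M, fun t ht => hM t ⟨zero_le, ht⟩⟩

variable {X : Type*} [NormedAddCommGroup X] [NormedSpace ℂ X] [CompleteSpace X]

/-- By the uniform boundedness principle, a strongly continuous semigroup is bounded in operator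
norm on bounded time intervals. -/
theorem OpSemigroup.exists_norm_le (Φ : OpSemigroup ℝ≥0 X) (R : ℝ≥0) :
    ∃ M, 0 ≤ M ∧ ∀ t ≤ R, ‖Φ t‖ ≤ M := by
  obtain ⟨M, hM⟩ := banach_steinhaus (g := fun t : Set.Iic R => Φ t) fun v => by
    obtain ⟨M, hM⟩ := exists_norm_le_of_continuous (Φ.strongly_continuous v) R
    exact ⟨M, fun t => hM t t.2⟩
  exact ⟨M, (norm_nonneg _).trans (hM ⟨R, Set.mem_Iic.2 le_rfl⟩), fun t ht => hM ⟨t, ht⟩⟩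

theorem OpSemigroup.continuous_uncurry (Φ : OpSemigroup ℝ≥0 X) :
    Continuous fun p : ℝ≥0 × X => Φ p.1 p.2 := by
  rw [continuous_iff_continuousAt]
  rintro ⟨t, v⟩
  obtain ⟨M, hM0, hM⟩ := Φ.exists_norm_le (t + 1)
  have h1 : Tendsto (fun p : ℝ≥0 × X => M * ‖p.2 - v‖ + ‖Φ p.1 v - Φ t v‖) (𝓝 (t, v)) (𝓝 0) := by
    have hc : Continuous fun p : ℝ≥0 × X => M * ‖p.2 - v‖ + ‖Φ p.1 v - Φ t v‖ := by
      have := (Φ.strongly_continuous v).comp (continuous_fst (X := ℝ≥0) (Y := X))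
      simp only [Function.comp_def] at this
      fun_prop
    simpa using hc.tendsto (t, v)
  refine tendsto_iff_norm_sub_tendsto_zero.2
    (squeeze_zero' (Eventually.of_forall fun p => norm_nonneg _) ?_ h1)
  have h2 : ∀ᶠ p : ℝ≥0 × X in 𝓝 (t, v), p.1 ≤ t + 1 :=
    (continuous_fst.tendsto (t, v)).eventually
      (eventually_le_nhds (show t < t + 1 from lt_add_one t))
  filter_upwards [h2] with p hp
  calc ‖Φ p.1 p.2 - Φ t v‖ = ‖Φ p.1 (p.2 - v) + (Φ p.1 v - Φ t v)‖ := by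
        rw [map_sub, sub_add_sub_cancel]
    _ ≤ ‖Φ p.1 (p.2 - v)‖ + ‖Φ p.1 v - Φ t v‖ := norm_add_le _ _
    _ ≤ M * ‖p.2 - v‖ + ‖Φ p.1 v - Φ t v‖ := by
        gcongr
        exact ((Φ p.1).le_opNorm _).trans (by gcongr; exact hM _ hp)

/-- `x` is a mild solution of `ẋ = A x + f`, where `A` is the generator of `Φ`: the variation of
constants formula holds. -/
def IsMildSolution (Φ : OpSemigroup ℝ≥0 X) (x f : ℝ≥0 → X) : Prop :=
  ∀ t : ℝ≥0, x t = Φ t (x 0) + ∫ s in (0 : ℝ)..(t : ℝ), Φ (t - s.toNNReal) (f s.toNNReal)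

theorem OpSemigroup.continuous_convolution (Φ : OpSemigroup ℝ≥0 X) {f : ℝ≥0 → X}
    (hf : Continuous f) (t : ℝ≥0) :
    Continuous fun s : ℝ => Φ (t - s.toNNReal) (f s.toNNReal) :=
  Φ.continuous_uncurry.comp ((continuous_const.sub continuous_real_toNNReal).prodMk
    (hf.comp continuous_real_toNNReal))

variable {Φ : OpSemigroup ℝ≥0 X} {x f : ℝ≥0 → X}

/-- Time invariance: the variation of constants formula started at time `t` instead of `0`. -/
theorem IsMildSolution.shift (hx : IsMildSolution Φ x f) (hf : Continuous f) (t h : ℝ≥0) :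
    x (t + h) = Φ h (x t) +
      ∫ s in (0 : ℝ)..(h : ℝ), Φ (h - s.toNNReal) (f (t + s.toNNReal)) := by
  have hint (a b : ℝ) (r : ℝ≥0) := (Φ.continuous_convolution hf r).intervalIntegrable a b
    (μ := MeasureTheory.volume)
  have h1 : ∫ s in (0 : ℝ)..(t : ℝ), Φ (t + h - s.toNNReal) (f s.toNNReal)
      = Φ h (∫ s in (0 : ℝ)..(t : ℝ), Φ (t - s.toNNReal) (f s.toNNReal)) := by
    rw [← ContinuousLinearMap.intervalIntegral_comp_comm _ (hint _ _ _)]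
    refine intervalIntegral.integral_congr fun s hs => ?_
    rw [Set.uIcc_of_le t.coe_nonneg] at hs
    have hs' : s.toNNReal ≤ t := Real.toNNReal_le_iff_le_coe.2 hs.2
    have h2 : t + h - s.toNNReal = h + (t - s.toNNReal) := by
      rw [add_comm t h, add_tsub_assoc_of_le hs']
    simp only [h2, Φ.map_add, ContinuousLinearMap.comp_apply]
  have h2 : ∫ s in (t : ℝ)..((t + h : ℝ≥0) : ℝ), Φ (t + h - s.toNNReal) (f s.toNNReal)
      = ∫ s in (0 : ℝ)..(h : ℝ), Φ (h - s.toNNReal) (f (t + s.toNNReal)) := by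
    have h3 := intervalIntegral.integral_comp_add_left (a := 0) (b := h)
      (fun s : ℝ => Φ (t + h - s.toNNReal) (f s.toNNReal)) (t : ℝ)
    rw [add_zero, ← NNReal.coe_add] at h3
    rw [← h3]
    refine intervalIntegral.integral_congr fun s hs => ?_
    rw [Set.uIcc_of_le h.coe_nonneg] at hs
    have h4 : ((t : ℝ) + s).toNNReal = t + s.toNNReal := by
      rw [Real.toNNReal_add t.coe_nonneg hs.1, Real.toNNReal_coe]
    simp only [h4, add_tsub_add_eq_tsub_left]
  rw [hx (t + h), ← intervalIntegral.integral_add_adjacent_intervals (hint 0 t (t + h))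
    (hint t _ (t + h)), h1, h2, hx t, map_add, add_comm t h, Φ.map_add,
    ContinuousLinearMap.comp_apply, add_assoc]

/-- The forcing term accumulated over a time window of fixed length vanishes if the forcing
does. -/
theorem tendsto_window_integral (Φ : OpSemigroup ℝ≥0 X) (hf : Tendsto f atTop (𝓝 0))
    (h : ℝ≥0) : Tendsto (fun t => ∫ s in (0 : ℝ)..(h : ℝ),
      Φ (h - s.toNNReal) (f (t + s.toNNReal))) atTop (𝓝 0) := by
  obtain ⟨M, hM0, hM⟩ := Φ.exists_norm_le h
  rw [Metric.tendsto_atTop]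
  intro ε hε
  set δ : ℝ := ε / (M * h + 1) with hδ
  have hpos : 0 < M * h + 1 := by positivity
  have hδ0 : 0 < δ := by positivity
  obtain ⟨T₀, hT₀⟩ := Metric.tendsto_atTop.1 hf δ hδ0
  refine ⟨T₀, fun t ht => ?_⟩
  rw [dist_zero_right]
  refine (intervalIntegral.norm_integral_le_of_norm_le_const (C := M * δ) fun s _ => ?_).trans_lt ?_
  · have h1 := hT₀ (t + s.toNNReal) (ht.trans le_self_add)
    rw [dist_zero_right] at h1
    exact ((Φ _).le_opNorm _).trans (mul_le_mul (hM _ tsub_le_self) h1.le (norm_nonneg _) hM0)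
  · rw [sub_zero, abs_of_nonneg h.coe_nonneg]
    have h2 : δ * (M * h + 1) = ε := div_mul_cancel₀ _ hpos.ne'
    change M * δ * h < ε
    nlinarith

/-- The derivative of a smooth mild solution is a mild solution for the derivative of the forcing
term: the difference quotients are mild solutions by time invariance, and one passes to the limit
in the variation of constants formula. -/
theorem IsMildSolution.deriv (hx : IsMildSolution Φ x f) {x' f' : ℝ≥0 → X}
    (hxd : HasTimeDeriv x x') (hfd : HasTimeDeriv f f') (hf' : Continuous f') :
    IsMildSolution Φ x' f' := by
  intro t
  have hf := hfd.continuous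
  have hint (g : ℝ≥0 → X) (hg : Continuous g) := (Φ.continuous_convolution hg t).intervalIntegrable
    0 t (μ := MeasureTheory.volume)
  have hquot (h : ℝ≥0) : (h : ℝ)⁻¹ • (x (h + t) - x t) = Φ t ((h : ℝ)⁻¹ • (x h - x 0)) +
      ∫ s in (0 : ℝ)..(t : ℝ), Φ (t - s.toNNReal)
        ((h : ℝ)⁻¹ • (f (h + s.toNNReal) - f s.toNNReal)) := by
    have hsmul (r : ℝ≥0) (v : X) : Φ r ((h : ℝ)⁻¹ • v) = (h : ℝ)⁻¹ • Φ r v :=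
      (Φ r).toLinearMap.map_smul_of_tower _ _
    simp only [hsmul, map_sub]
    rw [intervalIntegral.integral_smul, intervalIntegral.integral_sub
      (hint (fun r => f (h + r)) (hf.comp (continuous_const.add continuous_id))) (hint f hf),
      ← smul_add, hx.shift hf h t, hx t]
    congr 1
    abel
  have hshift (s : ℝ≥0) : Tendsto (fun h : ℝ≥0 => h + s) (𝓝[≠] 0) (𝓝[≠] s) := by
    refine tendsto_nhdsWithin_iff.2 ⟨?_, ?_⟩
    · have : Tendsto (fun h : ℝ≥0 => h + s) (𝓝 0) (𝓝 (0 + s)) :=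
        (continuous_id.add continuous_const).tendsto 0
      rw [zero_add] at this
      exact this.mono_left nhdsWithin_le_nhds
    · filter_upwards [self_mem_nhdsWithin] with h hh
      simpa using hh
  have hquotlim (g g' : ℝ≥0 → X) (hg : HasTimeDeriv g g') (s : ℝ≥0) :
      Tendsto (fun h : ℝ≥0 => (h : ℝ)⁻¹ • (g (h + s) - g s)) (𝓝[≠] 0) (𝓝 (g' s)) := by
    simpa [Function.comp_def] using (hg s).comp (hshift s)
  obtain ⟨M, hM0, hM⟩ := Φ.exists_norm_le t
  obtain ⟨L, hL⟩ := exists_norm_le_of_continuous hf' (1 + t)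
  have hone : ∀ᶠ h : ℝ≥0 in 𝓝[≠] 0, h ≤ 1 :=
    mem_nhdsWithin_of_mem_nhds (eventually_le_nhds (zero_lt_one' ℝ≥0))
  have hintlim : Tendsto (fun h : ℝ≥0 => ∫ s in (0 : ℝ)..(t : ℝ), Φ (t - s.toNNReal)
      ((h : ℝ)⁻¹ • (f (h + s.toNNReal) - f s.toNNReal))) (𝓝[≠] 0)
      (𝓝 (∫ s in (0 : ℝ)..(t : ℝ), Φ (t - s.toNNReal) (f' s.toNNReal))) := by
    refine intervalIntegral.tendsto_integral_filter_of_dominated_convergence (fun _ => M * L)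
      (Eventually.of_forall fun h => ?_) ?_ intervalIntegrable_const
      (MeasureTheory.ae_of_all _ fun s _ => ?_)
    · exact (Φ.continuous_convolution (f := fun r => (h : ℝ)⁻¹ • (f (h + r) - f r))
        (by fun_prop) t).aestronglyMeasurable
    · filter_upwards [hone, self_mem_nhdsWithin] with h hh1 hh0
      refine MeasureTheory.ae_of_all _ fun s hs => ?_
      rw [Set.uIoc_of_le t.coe_nonneg] at hs
      have hst : s.toNNReal ≤ t := Real.toNNReal_le_iff_le_coe.2 hs.2
      have hh : (0 : ℝ) < h := NNReal.coe_pos.2 (pos_iff_ne_zero.2 hh0)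
      refine ((Φ _).le_opNorm _).trans
        (mul_le_mul (hM _ tsub_le_self) ?_ (norm_nonneg _) hM0)
      rw [norm_smul, norm_inv, Real.norm_of_nonneg hh.le, inv_mul_le_iff₀ hh, mul_comm]
      exact hfd.norm_sub_le fun r hr => hL r (hr.trans (add_le_add hh1 hst))
    · exact ((Φ _).continuous.tendsto _).comp (hquotlim f f' hfd _)
  have hx0 := hquotlim x x' hxd 0
  simp only [add_zero] at hx0
  refine tendsto_nhds_unique (hquotlim x x' hxd t) ?_
  simp only [hquot]
  exact (((Φ t).continuous.tendsto _).comp hx0).add hintlim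

end Mild
/-! ### Smoothness of orbits in finite-dimensional invariant subspaces -/

section FiniteDimensional

variable {E : Type*} [NormedAddCommGroup E] [NormedSpace ℂ E]

/-- The restriction of a semigroup to an invariant subspace. -/
def OpSemigroup.restrict {T : Type*} [AddMonoid T] [TopologicalSpace T] (Φ : OpSemigroup T E)
    (V : Submodule ℂ E) (hV : ∀ t, ∀ v ∈ V, Φ t v ∈ V) : OpSemigroup T V where
  toFun t := ((Φ t).comp V.subtypeL).codRestrict V fun v => hV t v v.2
  map_zero := by ext v; simp [Φ.map_zero]
  map_add t s := by ext v; exact congrArg (fun L : E →L[ℂ] E => L v) (Φ.map_add t s)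
  strongly_continuous v := (Φ.strongly_continuous v).subtype_mk _

/-- The orbit of the averaged vector `∫₀ʰ Φ(r) v dr` is differentiable. -/
theorem OpSemigroup.hasTimeDeriv_integral [CompleteSpace E] (Φ : OpSemigroup ℝ≥0 E) (v : E)
    (h : ℝ≥0) :
    HasTimeDeriv (fun t => Φ t (∫ r in (0 : ℝ)..(h : ℝ), Φ r.toNNReal v))
      (fun t => Φ t (Φ h v - v)) := by
  set G : ℝ → E := fun r => Φ r.toNNReal v with hG
  have hGc : Continuous G := (Φ.strongly_continuous v).comp continuous_real_toNNReal
  have hG0 (t : ℝ≥0) : G t = Φ t v := by simp [hG]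
  have hint (a b : ℝ) := hGc.intervalIntegrable a b (μ := MeasureTheory.volume)
  have horbit (t : ℝ≥0) : Φ t (∫ r in (0 : ℝ)..(h : ℝ), G r)
      = (∫ r in (0 : ℝ)..((t : ℝ) + h), G r) - ∫ r in (0 : ℝ)..(t : ℝ), G r := by
    rw [intervalIntegral.integral_interval_sub_left (hint _ _) (hint _ _),
      ← ContinuousLinearMap.intervalIntegral_comp_comm _ (hint _ _)]
    have h1 := intervalIntegral.integral_comp_add_left (a := 0) (b := h) G (t : ℝ)
    rw [add_zero] at h1
    rw [← h1]
    refine intervalIntegral.integral_congr fun s hs => ?_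
    rw [Set.uIcc_of_le h.coe_nonneg] at hs
    simp only [hG]
    rw [Real.toNNReal_add t.coe_nonneg hs.1, Real.toNNReal_coe, Φ.map_add]
    rfl
  rw [hasTimeDeriv_iff]
  intro t
  have hd (a : ℝ) : HasDerivAt (fun b => ∫ r in (0 : ℝ)..b, G r) (G a) a :=
    (hGc.integral_hasStrictDerivAt 0 a).hasDerivAt
  have h1 : HasDerivAt (fun a : ℝ => (∫ r in (0 : ℝ)..(a + h), G r) - ∫ r in (0 : ℝ)..a, G r)
      (G (t + h) - G t) t := ((hd (t + h)).comp_add_const (t : ℝ) (h : ℝ)).sub (hd t)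
  have h2 : Φ t (Φ h v - v) = G (t + h) - G t := by
    rw [← NNReal.coe_add, hG0, hG0, map_sub, Φ.map_add]
    rfl
  rw [h2]
  refine h1.hasDerivWithinAt.congr (fun r hr => ?_) ?_
  · have h3 := horbit r.toNNReal
    rwa [Real.coe_toNNReal r hr] at h3
  · simpa only [Real.toNNReal_coe] using horbit t

/-- On a finite-dimensional space all orbits are differentiable: the vectors with differentiable
orbit form a subspace, which is dense since it contains the averages of all orbits. -/
theorem OpSemigroup.exists_hasTimeDeriv_of_finiteDimensional [FiniteDimensional ℂ E]
    (Φ : OpSemigroup ℝ≥0 E) :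
    ∃ A : E → E, ∀ v, HasTimeDeriv (fun t => Φ t v) (fun t => Φ t (A v)) := by
  let W : Submodule ℂ E :=
    { carrier := {v | ∃ w, HasTimeDeriv (fun t => Φ t v) (fun t => Φ t w)}
      add_mem' := by
        rintro a b ⟨a', ha⟩ ⟨b', hb⟩
        exact ⟨a' + b', by simpa only [_root_.map_add] using ha.add hb⟩
      zero_mem' := ⟨0, by simpa only [_root_.map_zero] using hasTimeDeriv_zero⟩
      smul_mem' := by
        rintro c a ⟨a', ha⟩
        refine ⟨c • a', ?_⟩
        simpa using ha.clm_comp (c • ContinuousLinearMap.id ℂ E) }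
  suffices h : ∀ v, v ∈ W by
    choose A hA using h
    exact ⟨A, hA⟩
  intro v
  have : CompleteSpace E := FiniteDimensional.complete ℂ E
  have hcl : IsClosed (W : Set E) := W.closed_of_finiteDimensional
  set G : ℝ → E := fun r => Φ r.toNNReal v with hG
  have hGc : Continuous G := (Φ.strongly_continuous v).comp continuous_real_toNNReal
  have hd : HasDerivAt (fun b => ∫ r in (0 : ℝ)..b, G r) (G 0) 0 :=
    (hGc.integral_hasStrictDerivAt 0 0).hasDerivAt
  have hlim := hd.hasDerivWithinAt (s := Set.Ioi 0)
  rw [hasDerivWithinAt_iff_tendsto_slope' (by simp)] at hlim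
  have hG0 : G 0 = v := by simp [hG, Φ.map_zero]
  rw [hG0] at hlim
  refine hcl.mem_of_tendsto hlim ?_
  filter_upwards [self_mem_nhdsWithin] with h hh
  have hmem : ∫ r in (0 : ℝ)..(h.toNNReal : ℝ), G r ∈ W := ⟨_, Φ.hasTimeDeriv_integral v _⟩
  rw [Real.coe_toNNReal h (le_of_lt hh)] at hmem
  rw [slope_def_module, intervalIntegral.integral_same, sub_zero, sub_zero]
  exact (W.restrictScalars ℝ).smul_mem _ hmem

theorem OpSemigroup.exists_isDerivSeq_of_finiteDimensional (Φ : OpSemigroup ℝ≥0 E)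
    (V : Submodule ℂ E) [FiniteDimensional ℂ V] (hV : ∀ t, ∀ v ∈ V, Φ t v ∈ V) {v : E}
    (hv : v ∈ V) : ∃ d, IsDerivSeq (fun t => Φ t v) d := by
  obtain ⟨A, hA⟩ := (Φ.restrict V hV).exists_hasTimeDeriv_of_finiteDimensional
  refine ⟨fun k t => Φ t (A^[k] ⟨v, hv⟩ : V), rfl, fun k => ?_⟩
  have h := (hA (A^[k] ⟨v, hv⟩)).clm_comp V.subtypeL
  rw [← Function.iterate_succ_apply' A k] at h
  exact h

end FiniteDimensional

/-! ### Continuous time -/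

section Continuous

variable {X U Y : Type*} [NormedAddCommGroup X] [NormedSpace ℂ X] [CompleteSpace X]
  [AddCommGroup U] [Module ℂ U] [TopologicalSpace U]
  [AddCommGroup Y] [Module ℂ Y] [TopologicalSpace Y]

theorem tfae_stable_continuous [IsTopologicalAddGroup Y] [ContinuousSMul ℂ Y]
    [T2Space Y] (B : U →L[ℂ] X) (C : X →L[ℂ] Y) (D : U →L[ℂ] Y) (Φ : OpSemigroup ℝ≥0 X)
    (hΦ : IsCompactOperator (Φ 1)) :
    List.TFAE [Stable (semigroupRelation Φ B C D),
      ∀ v : X, IsUnstableGenEigenvector (Φ 1) v → v ∈ unobservableSubspace Φ C,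
      VIVO (semigroupRelation Φ B C D),
      SmoothlyVIVO (semigroupRelation Φ B C D)] := by
  have hΦnat (m : ℕ) : Φ m = Φ 1 ^ m := by rw [← Φ.map_nsmul, nsmul_one]
  have hdecay (h : ∀ v : X, IsUnstableGenEigenvector (Φ 1) v → v ∈ unobservableSubspace Φ C)
      (x f : ℝ≥0 → X) (hx : IsMildSolution Φ x f) (hxc : Continuous x) (hfc : Continuous f)
      (hf : Tendsto f atTop (𝓝 0)) : Tendsto (fun t => C (x t)) atTop (𝓝 0) := by
    obtain ⟨m, -, hm⟩ := exists_forall_tendsto_output hΦ (isClosed_unobservableSubspace Φ C)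
      (fun v hv => apply_mem_unobservableSubspace 1 hv)
      (fun v hv => apply_eq_zero_of_mem_unobservableSubspace hv) h
    exact hm x _ (fun t => by rw [hx.shift hfc t m, ← hΦnat]) (tendsto_window_integral Φ hf m)
      (exists_norm_le_of_continuous hxc)
  tfae_have 1 → 2 := by
    rintro h v ⟨lam, k, hlam, hv⟩
    have hlam0 : lam ≠ 0 := norm_pos_iff.1 (by linarith)
    refine mem_unobservableSubspace_of_tendsto Φ C 1 hlam k (fun w hw => ?_) hv
    have := hΦ.finiteDimensional_ker_pow hlam0 k
    obtain ⟨d, hd⟩ := Φ.exists_isDerivSeq_of_finiteDimensional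
      ((lam • ContinuousLinearMap.id ℂ X - Φ 1) ^ k).ker
      (fun t _ hw => LinearMap.mem_ker.2 (Φ.mem_ker_pow 1 lam k (LinearMap.mem_ker.1 hw) t))
      (LinearMap.mem_ker.2 hw)
    have hy : Vanishes fun t => C (Φ t w) := by
      refine h _ ⟨⟨_, isDerivSeq_zero⟩, ⟨_, hd.clm_comp C⟩, fun t => Φ t w, ⟨d, hd⟩, ?_, ?_⟩
      · intro t; simp [Φ.map_zero]
      · intro t; simp
    refine (hy.comp (tendsto_natCast_atTop_atTop (R := ℝ≥0))).congr fun n => ?_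
    simp only [Function.comp_apply, hΦnat]
  tfae_have 2 → 3 := by
    rintro h u y ⟨⟨ud, hud⟩, -, x, hxs, hx, hy⟩ hu
    have hBu : IsSmooth fun t => B (u t) := ⟨_, hud.clm_comp B⟩
    have := (hdecay h x (fun t => B (u t)) hx hxs.continuous hBu.continuous
      (tendsto_clm_zero B hu)).add (tendsto_clm_zero D hu)
    rw [add_zero] at this
    exact this.congr fun t => (hy t).symm
  tfae_have 2 → 4 := by
    rintro h u y ⟨-, -, x, ⟨xd, hxd⟩, hx, hy⟩ ⟨ud, hud, hu⟩
    have hBud := hud.clm_comp B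
    have hmild (k : ℕ) : IsMildSolution Φ (xd k) (fun t => B (ud k t)) := by
      induction k with
      | zero => rw [hxd.1, hud.1]; exact hx
      | succ k ih => exact ih.deriv (hxd.2 k) (hBud.2 k) (hBud.2 (k + 1)).continuous
    have hyd := (hxd.clm_comp C).add (hud.clm_comp D)
    rw [← (funext hy : y = fun t => C (x t) + D (u t))] at hyd
    refine ⟨_, hyd, fun k => ?_⟩
    have := (hdecay h _ _ (hmild k) (hxd.2 k).continuous (hBud.2 k).continuous
      (tendsto_clm_zero B (hu k))).add (tendsto_clm_zero D (hu k))
    rwa [add_zero] at this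
  tfae_have 3 → 1 := fun h y hy => h _ y hy tendsto_const_nhds
  tfae_have 4 → 1 := by
    intro h y hy
    obtain ⟨d, hd, hd0⟩ := h _ y hy ⟨_, isDerivSeq_zero, fun _ => tendsto_const_nhds⟩
    exact hd.1 ▸ hd0 0
  tfae_finish

end Continuous

/-! ### Systems defined by a bounded generator -/

section Exponential

variable {X U Y : Type*} [NormedAddCommGroup X] [NormedSpace ℂ X]
  [AddCommGroup U] [Module ℂ U] [TopologicalSpace U]
  [AddCommGroup Y] [Module ℂ Y] [TopologicalSpace Y]

/-- The product rule for a real-time family of `ℂ`-linear operators applied to a curve. -/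
theorem hasDerivWithinAt_clm_apply {L : ℝ → X →L[ℂ] X} {L' : X →L[ℂ] X} {g : ℝ → X} {g' : X}
    {s : Set ℝ} {t : ℝ} (hL : HasDerivWithinAt L L' s t) (hg : HasDerivWithinAt g g' s t) :
    HasDerivWithinAt (fun r => L r (g r)) (L' (g t) + L t g') s t := by
  have h := (ContinuousLinearMap.restrictScalarsL ℂ X X ℝ ℝ).hasFDerivAt.comp_hasDerivWithinAt t hL
  exact h.clm_apply hg

/-- The derivatives of a solution of `ẋ = A x + f` are given by `x⁽ᵏ⁺¹⁾ = A x⁽ᵏ⁾ + f⁽ᵏ⁾`. -/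
theorem isSmooth_of_hasTimeDeriv {A : X →L[ℂ] X} {x f : ℝ≥0 → X} (hf : IsSmooth f)
    (hx : HasTimeDeriv x fun t => A (x t) + f t) : IsSmooth x := by
  obtain ⟨fd, rfl, hfd⟩ := hf
  let d : ℕ → ℝ≥0 → X := fun k => Nat.rec x (fun k dk t => A (dk t) + fd k t) k
  refine ⟨d, rfl, fun k => ?_⟩
  induction k with
  | zero => exact hx
  | succ k ih => exact (ih.clm_comp A).add (hfd k)

/-- The discrete semigroup `n ↦ A ^ n`. -/
def powSemigroup (A : X →L[ℂ] X) : OpSemigroup ℕ X where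
  toFun n := A ^ n
  map_zero := pow_zero A
  map_add m n := pow_add A m n
  strongly_continuous _ := continuous_of_discreteTopology

theorem ltiRelationDiscrete_eq_semigroupRelationDiscrete (A : X →L[ℂ] X) (B : U →L[ℂ] X)
    (C : X →L[ℂ] Y) (D : U →L[ℂ] Y) :
    ltiRelationDiscrete A B C D = semigroupRelationDiscrete (powSemigroup A) B C D := by
  ext ⟨u, y⟩
  refine exists_congr fun x => and_congr_left fun _ => ?_
  rw [eq_sum_iff_forall_succ (powSemigroup A) x fun s => B (u s)]
  simp [powSemigroup]

variable [CompleteSpace X]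

theorem hasDerivAt_exp_smul (A : X →L[ℂ] X) (t : ℝ) :
    HasDerivAt (fun r : ℝ => NormedSpace.exp (r • A)) (A * NormedSpace.exp (t • A)) t :=
  hasDerivAt_exp_smul_const' A t

theorem exp_add_smul (A : X →L[ℂ] X) (t s : ℝ) :
    NormedSpace.exp ((t + s) • A) = NormedSpace.exp (t • A) * NormedSpace.exp (s • A) := by
  let : NormedAlgebra ℚ (X →L[ℂ] X) := .restrictScalars ℚ ℂ _
  rw [add_smul, NormedSpace.exp_add_of_commute (((Commute.refl A).smul_left t).smul_right s)]

/-- The semigroup `t ↦ exp (t A)`. -/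
noncomputable def expSemigroup (A : X →L[ℂ] X) : OpSemigroup ℝ≥0 X where
  toFun t := NormedSpace.exp ((t : ℝ) • A)
  map_zero := by rw [NNReal.coe_zero, zero_smul, NormedSpace.exp_zero]; rfl
  map_add t s := by
    rw [NNReal.coe_add, exp_add_smul]
    rfl
  strongly_continuous x := by
    have h : Continuous fun r : ℝ => NormedSpace.exp (r • A) :=
      continuous_iff_continuousAt.2 fun t => (hasDerivAt_exp_smul A t).continuousAt
    exact (h.comp NNReal.continuous_coe).clm_apply continuous_const

theorem expSemigroup_hasTimeDeriv (A : X →L[ℂ] X) (v : X) :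
    HasTimeDeriv (fun t => expSemigroup A t v) (fun t => A (expSemigroup A t v)) := by
  rw [hasTimeDeriv_iff]
  intro t
  have h := hasDerivWithinAt_clm_apply (hasDerivAt_exp_smul A t).hasDerivWithinAt
    (hasDerivWithinAt_const (t : ℝ) (Set.Ici 0) v)
  rw [map_zero, add_zero] at h
  refine h.congr (fun r hr => ?_) ?_
  · simp [expSemigroup, Real.coe_toNNReal r hr]
  · simp [expSemigroup]

/-- A solution of `ẋ = A x + f` satisfies the variation of constants formula: integrate the
derivative of `s ↦ exp ((t - s) A) x(s)`. -/
theorem isMildSolution_of_hasTimeDeriv {A : X →L[ℂ] X} {x f : ℝ≥0 → X} (hf : Continuous f)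
    (hx : HasTimeDeriv x fun t => A (x t) + f t) : IsMildSolution (expSemigroup A) x f := by
  intro t
  have hexp (s : ℝ) : HasDerivAt (fun r : ℝ => NormedSpace.exp (((t : ℝ) - r) • A))
      (-(NormedSpace.exp (((t : ℝ) - s) • A) * A)) s := by
    have h := (hasDerivAt_exp_smul_const A ((t : ℝ) - s)).scomp s
      ((hasDerivAt_id s).const_sub (t : ℝ))
    simpa [Function.comp_def] using h
  have hcont : Continuous fun s : ℝ => NormedSpace.exp (((t : ℝ) - s) • A) (x s.toNNReal) :=
    (continuous_iff_continuousAt.2 fun s => (hexp s).continuousAt).clm_apply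
      (hx.continuous.comp continuous_real_toNNReal)
  have hftc := intervalIntegral.integral_eq_sub_of_hasDeriv_right_of_le
    (f := fun s : ℝ => NormedSpace.exp (((t : ℝ) - s) • A) (x s.toNNReal))
    (f' := fun s : ℝ => expSemigroup A (t - s.toNNReal) (f s.toNNReal)) t.coe_nonneg
    hcont.continuousOn (fun s hs => ?_)
    (((expSemigroup A).continuous_convolution hf t).intervalIntegrable _ _)
  · rw [hftc]
    simp [expSemigroup]
  · have hd := hasDerivWithinAt_clm_apply (hexp s).hasDerivWithinAt
      ((hx.hasDerivAt hs.1).hasDerivWithinAt (s := Set.Ioi s))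
    have hst : s.toNNReal ≤ t := Real.toNNReal_le_iff_le_coe.2 hs.2.le
    have heq : expSemigroup A (t - s.toNNReal) (f s.toNNReal)
        = (-(NormedSpace.exp (((t : ℝ) - s) • A) * A)) (x s.toNNReal)
          + NormedSpace.exp (((t : ℝ) - s) • A) (A (x s.toNNReal) + f s.toNNReal) := by
      simp [expSemigroup, NNReal.coe_sub hst, Real.coe_toNNReal s hs.1.le]
    rw [heq]
    exact hd

/-- The equation `ẋ = A x + f` is solved by `x(t) = exp (t A) ∫₀ᵗ exp (-s A) f(s) ds`. -/
theorem exists_hasTimeDeriv (A : X →L[ℂ] X) {f : ℝ≥0 → X} (hf : Continuous f) :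
    ∃ x : ℝ≥0 → X, HasTimeDeriv x fun t => A (x t) + f t := by
  set G : ℝ → X := fun s => NormedSpace.exp ((-s) • A) (f s.toNNReal) with hG
  have hexp : Continuous fun r : ℝ => NormedSpace.exp (r • A) :=
    continuous_iff_continuousAt.2 fun t => (hasDerivAt_exp_smul A t).continuousAt
  have hGc : Continuous G :=
    (hexp.comp continuous_neg).clm_apply (hf.comp continuous_real_toNNReal)
  refine ⟨fun t => NormedSpace.exp ((t : ℝ) • A) (∫ s in (0 : ℝ)..t, G s), ?_⟩
  rw [hasTimeDeriv_iff]
  intro t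
  have h := hasDerivWithinAt_clm_apply (hasDerivAt_exp_smul A t).hasDerivWithinAt
    (hGc.integral_hasStrictDerivAt 0 (t : ℝ)).hasDerivAt.hasDerivWithinAt (s := Set.Ici 0)
  have h1 : NormedSpace.exp ((t : ℝ) • A) (G t) = f t := by
    simp only [hG, Real.toNNReal_coe]
    rw [← mul_apply_eq_comp, ← exp_add_smul, add_neg_cancel, zero_smul, NormedSpace.exp_zero,
      one_apply_eq_self]
  rw [h1] at h
  refine h.congr (fun r hr => ?_) ?_
  · rw [Real.coe_toNNReal r hr]
  · rw [Real.toNNReal_coe]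

theorem ltiRelation_subset_semigroupRelation (A : X →L[ℂ] X) (B : U →L[ℂ] X) (C : X →L[ℂ] Y)
    (D : U →L[ℂ] Y) : ltiRelation A B C D ⊆ semigroupRelation (expSemigroup A) B C D := by
  rintro ⟨u, y⟩ ⟨⟨ud, hud⟩, hy, x, hxs, hx, hyx⟩
  have hBu : IsSmooth fun t => B (u t) := ⟨_, hud.clm_comp B⟩
  exact ⟨⟨ud, hud⟩, hy, x, hxs, isMildSolution_of_hasTimeDeriv hBu.continuous hx, hyx⟩

/-- For the zero input, mild solutions `exp (t A) x(0)` solve the differential equation. -/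
theorem stable_semigroupRelation_of_stable_ltiRelation {A : X →L[ℂ] X} {B : U →L[ℂ] X}
    {C : X →L[ℂ] Y} {D : U →L[ℂ] Y} (h : Stable (ltiRelation A B C D)) :
    Stable (semigroupRelation (expSemigroup A) B C D) := by
  rintro y ⟨hu, hy, x, hxs, hx, hyx⟩
  refine h y ⟨hu, hy, x, hxs, ?_, hyx⟩
  have hx' : x = fun t => expSemigroup A t (x 0) := funext fun t => by
    have h1 := hx t
    simpa using h1
  have h2 := expSemigroup_hasTimeDeriv A (x 0)
  rw [← hx'] at h2
  have h3 (t : ℝ≥0) : expSemigroup A t (x 0) = x t := (congrFun hx' t).symm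
  simpa [h3] using h2

theorem inputResilient_ltiRelation [IsTopologicalAddGroup Y] [ContinuousSMul ℂ Y] [T2Space Y]
    [FiniteDimensional ℂ X] (A : X →L[ℂ] X) (B : U →L[ℂ] X) (C : X →L[ℂ] Y) (D : U →L[ℂ] Y) :
    InputResilient (ltiRelation A B C D) := by
  refine ⟨fun u hu => ?_, fun h => ?_⟩
  · obtain ⟨ud, hud⟩ := hu
    have hBu : IsSmooth fun t => B (u t) := ⟨_, hud.clm_comp B⟩
    obtain ⟨x, hx⟩ := exists_hasTimeDeriv A hBu.continuous
    obtain ⟨xd, hxd⟩ := isSmooth_of_hasTimeDeriv hBu hx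
    exact ⟨fun t => C (x t) + D (u t), ⟨ud, hud⟩, ⟨_, (hxd.clm_comp C).add (hud.clm_comp D)⟩, x,
      ⟨xd, hxd⟩, hx, fun _ => rfl⟩
  · have : ProperSpace X := FiniteDimensional.proper ℂ X
    have hcomp : IsCompactOperator (expSemigroup A 1) :=
      isCompactOperator_of_locallyCompactSpace_rng _
    have hvivo := ((tfae_stable_continuous B C D _ hcomp).out 0 3).1
      (stable_semigroupRelation_of_stable_ltiRelation h)
    exact fun u y huy => hvivo u y (ltiRelation_subset_semigroupRelation A B C D huy)

theorem inputResilientDiscrete_ltiRelationDiscrete [IsTopologicalAddGroup Y] [ContinuousSMul ℂ Y]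
    [T2Space Y] [FiniteDimensional ℂ X] (A : X →L[ℂ] X) (B : U →L[ℂ] X) (C : X →L[ℂ] Y)
    (D : U →L[ℂ] Y) : InputResilientDiscrete (ltiRelationDiscrete A B C D) := by
  refine ⟨fun u => ?_, fun h => ?_⟩
  · let x : ℕ → X := fun k => Nat.rec 0 (fun k xk => A xk + B (u (k + 1))) k
    exact ⟨fun k => C (x k) + D (u k), x, fun _ => rfl, fun _ => rfl⟩
  · have : ProperSpace X := FiniteDimensional.proper ℂ X
    have hcomp : IsCompactOperator (powSemigroup A 1) :=
      isCompactOperator_of_locallyCompactSpace_rng _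
    rw [ltiRelationDiscrete_eq_semigroupRelationDiscrete] at h ⊢
    exact ((tfae_stable_discrete B C D _ hcomp).out 0 2).1 h

end Exponential

end InputOutput

theorem mainTheorem4 {X U Y : Type*}
    -- the state space `X` is a Banach space
    [NormedAddCommGroup X] [NormedSpace ℂ X] [CompleteSpace X]
    -- the input space `U` and the output space `Y` are Fréchet spaces
    [AddCommGroup U] [Module ℂ U] [UniformSpace U] [IsUniformAddGroup U] [ContinuousSMul ℂ U]
    [LocallyConvexSpace ℝ U] [(uniformity U).IsCountablyGenerated] [T2Space U] [CompleteSpace U]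
    [AddCommGroup Y] [Module ℂ Y] [UniformSpace Y] [IsUniformAddGroup Y] [ContinuousSMul ℂ Y]
    [LocallyConvexSpace ℝ Y] [(uniformity Y).IsCountablyGenerated] [T2Space Y] [CompleteSpace Y]
    (B : U →L[ℂ] X) (C : X →L[ℂ] Y) (D : U →L[ℂ] Y) :
    -- continuous time
    (∀ Φ : InputOutput.OpSemigroup ℝ≥0 X, IsCompactOperator (Φ 1) →
      List.TFAE [
        InputOutput.Stable (InputOutput.semigroupRelation Φ B C D),
        ∀ v : X, InputOutput.IsUnstableGenEigenvector (Φ 1) v →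
          v ∈ InputOutput.unobservableSubspace Φ C,
        InputOutput.VIVO (InputOutput.semigroupRelation Φ B C D),
        InputOutput.SmoothlyVIVO (InputOutput.semigroupRelation Φ B C D)]) ∧
    -- discrete time
    (∀ Φ : InputOutput.OpSemigroup ℕ X, IsCompactOperator (Φ 1) →
      List.TFAE [
        InputOutput.Stable (InputOutput.semigroupRelationDiscrete Φ B C D),
        ∀ v : X, InputOutput.IsUnstableGenEigenvector (Φ 1) v →
          v ∈ InputOutput.unobservableSubspace Φ C,
        InputOutput.VIVO (InputOutput.semigroupRelationDiscrete Φ B C D)]) ∧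
    -- systems with finite-dimensional state space
    (FiniteDimensional ℂ X → ∀ A : X →L[ℂ] X,
      InputOutput.InputResilient (InputOutput.ltiRelation A B C D) ∧
      InputOutput.InputResilientDiscrete (InputOutput.ltiRelationDiscrete A B C D)) := by
  refine ⟨fun Φ hΦ => InputOutput.tfae_stable_continuous B C D Φ hΦ,
    fun Φ hΦ => InputOutput.tfae_stable_discrete B C D Φ hΦ, fun _ A =>
    ⟨InputOutput.inputResilient_ltiRelation A B C D,
      InputOutput.inputResilientDiscrete_ltiRelationDiscrete A B C D⟩⟩
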